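/- Let $\sigma\subset\mathbb{R}^2$ be the cone generated by $(0,1)$ and $(4,-3)$, let $\sigma_{\mathbb{Z}}=\sigma^\vee\cap\mathbb{Z}^2$, and let $S=\mathbb{C}[\sigma_{\mathbb{Z}}]=\mathbb{C}[u,u^3v^4,uv]\subset\mathbb{C}[u,v]$, whose monomials $u^av^b$ are identified with the points $(a,b)\in\sigma_{\mathbb{Z}}$. Let $n>0$ be an integer and $J_n=\langle u-1,\,u^3v^4-1,\,uv-1\rangle^{n+1}\subset S$. Let $\preceq$ be the monomial ordering on $S$ with $\beta\preceq\alpha$ if and only if $(2,-1)\cdot\beta<(2,-1)\cdot\alpha$, or $(2,-1)\cdot\beta=(2,-1)\cdot\alpha$ and $(1,1)\cdot\beta\le(1,1)\cdot\alpha$. A finite set $G$ of nonzero elements of $J_n$ is a reduced Gröbner basis of $J_n$ with respect to $\preceq$ if the leading monomial of every nonzero element of $J_n$ is divisible in $S$ by the leading monomial of some element of $G$, every element of $G$ has leading coefficient $1$, and no monomial of any $g\in G$ is divisible in $S$ by the leading monomial of another element of $G$. For $w\in\sigma$ let $\mathrm{in}_w(f)$ be the sum of the terms of $f\in S$ of maximal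 $w$-weight (with $\mathrm{in}_w(0)=0$), let $\mathrm{in}_w(J_n)=\langle \mathrm{in}_w(f)\mid f\in J_n\rangle$, and let $C[w]=\{w'\in\sigma\mid \mathrm{in}_{w'}(J_n)=\mathrm{in}_w(J_n)\}$; the Gröbner fan of $J_n$ is the set of the closures $\overline{C[w]}$, $w\in\sigma$. Then $J_n$ has exactly one reduced Gröbner basis $G$ with respect to $\preceq$. Write $\mathrm{lm}(g)\in\sigma_{\mathbb{Z}}$ for the leading monomial of $g$ and $\mathrm{supp}(g)\subset\sigma_{\mathbb{Z}}$ for the set of monomials occurring in $g$. The cone $$C_{\mathbb{G}_n}=\{\,w\in\sigma\mid(\mathrm{lm}(g)-\beta)\cdot w\ge 0\text{ for all }g\in G\text{ and all }\beta\in\mathrm{supp}(g)\,\}$$ is a two-dimensional cone of the Gröbner fan of $J_n$, and its rays (one-dimensional faces) are exactly $L_1=\mathbb{R}_{\ge0}(2,-1)$ and $L_2=\mathbb{R}_{\ge0}\,l_n$, where $l_n=(2n-2,\,-n+2)$ if $n$ is odd and $l_n=(2n,\,-n+1)$ if $n$ is even. -/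

import Mathlib

noncomputable section

namespace A3Nash

/-! ### The cone, its dual semigroup and the monomial subalgebra -/

/-- The pairing of a real weight vector with a lattice point (standard inner product). -/
def dot (w : ℝ × ℝ) (a : ℤ × ℤ) : ℝ := w.1 * (a.1 : ℝ) + w.2 * (a.2 : ℝ)

lemma dot_add_left (w w' : ℝ × ℝ) (a : ℤ × ℤ) : dot (w + w') a = dot w a + dot w' a := by
  simp only [dot, Prod.fst_add, Prod.snd_add]; ring

lemma dot_smul_left (c : ℝ) (w : ℝ × ℝ) (a : ℤ × ℤ) : dot (c • w) a = c * dot w a := by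
  simp only [dot, Prod.smul_fst, Prod.smul_snd, smul_eq_mul]; ring

lemma dot_add_right (w : ℝ × ℝ) (a b : ℤ × ℤ) : dot w (a + b) = dot w a + dot w b := by
  simp only [dot, Prod.fst_add, Prod.snd_add]; push_cast; ring

/-- The cone `σ` generated by `(0, 1)` and `(4, -3)`. -/
def sigma : PointedCone ℝ (ℝ × ℝ) := PointedCone.hull ℝ {((0 : ℝ), (1 : ℝ)), ((4 : ℝ), (-3 : ℝ))}

/-- The semigroup `σ_ℤ = σ^∨ ∩ ℤ²` of lattice points of the dual cone. -/
def sigmaZ : AddSubmonoid (ℤ × ℤ) where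
  carrier := {a | ∀ w ∈ sigma, 0 ≤ dot w a}
  zero_mem' := by intro w _; simp [dot]
  add_mem' := by
    intro a b ha hb w hw
    rw [dot_add_right]
    exact add_nonneg (ha w hw) (hb w hw)

lemma mem_sigmaZ {a : ℤ × ℤ} : a ∈ sigmaZ ↔ 0 ≤ a.2 ∧ 0 ≤ 4 * a.1 - 3 * a.2 := by
  constructor
  · intro h
    have h1 := h (0, 1) (PointedCone.subset_hull (by simp))
    have h2 := h (4, -3) (PointedCone.subset_hull (by simp))
    simp only [dot] at h1 h2
    constructor
    · have : (0 : ℝ) ≤ (a.2 : ℝ) := by linarith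
      exact_mod_cast this
    · have : (0 : ℝ) ≤ 4 * (a.1 : ℝ) - 3 * (a.2 : ℝ) := by linarith
      exact_mod_cast this
  · rintro ⟨h1, h2⟩ w hw
    have h1' : (0 : ℝ) ≤ (a.2 : ℝ) := by exact_mod_cast h1
    have h2' : (0 : ℝ) ≤ 4 * (a.1 : ℝ) - 3 * (a.2 : ℝ) := by exact_mod_cast h2
    obtain ⟨s, t, rfl⟩ := Submodule.mem_span_pair.1 hw
    change 0 ≤ dot ((s : ℝ) • ((0 : ℝ), (1 : ℝ)) + (t : ℝ) • ((4 : ℝ), (-3 : ℝ))) a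
    rw [dot_add_left, dot_smul_left, dot_smul_left]
    refine add_nonneg (mul_nonneg s.2 ?_) (mul_nonneg t.2 ?_) <;> simp only [dot] <;> linarith

/-- The monomial algebra `S = ℂ[σ_ℤ] = ℂ[u, u³v⁴, uv] ⊆ ℂ[u, v]`; the monomial `u^a v^b` of `S` is
the basis element at `(a, b) ∈ σ_ℤ`, and `f.coeff.support` is the set of monomials of `f`. -/
abbrev S : Type := AddMonoidAlgebra ℂ sigmaZ

/-- The monomial `u` of `S`. -/
def xu : S := AddMonoidAlgebra.single ⟨(1, 0), mem_sigmaZ.2 (by norm_num)⟩ 1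

/-- The monomial `u³v⁴` of `S`. -/
def xu3v4 : S := AddMonoidAlgebra.single ⟨(3, 4), mem_sigmaZ.2 (by norm_num)⟩ 1

/-- The monomial `uv` of `S`. -/
def xuv : S := AddMonoidAlgebra.single ⟨(1, 1), mem_sigmaZ.2 (by norm_num)⟩ 1

/-- The ideal `J_n = ⟨u - 1, u³v⁴ - 1, uv - 1⟩^(n+1)` of `S`. -/
def J (n : ℕ) : Ideal S := Ideal.span {xu - 1, xu3v4 - 1, xuv - 1} ^ (n + 1)

/-! ### Gröbner bases in `S` -/

/-- Divisibility in `S` of the monomial with exponent `α` by the one with exponent `β`. -/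
def Divides (β α : sigmaZ) : Prop := ∃ γ : sigmaZ, α = β + γ

/-- `α` is (the exponent of) the leading monomial of `f` for the total ordering `r`, where
`r β α` stands for `β ≼ α`. -/
def IsLeadingMonomial (r : sigmaZ → sigmaZ → Prop) (f : S) (α : sigmaZ) : Prop :=
  α ∈ f.coeff.support ∧ ∀ β ∈ f.coeff.support, r β α

/-- A finite set `G` of nonzero elements of `I` is a Gröbner basis of `I` if the leading monomial
of each nonzero element of `I` is divisible in `S` by that of some element of `G`. -/
structure IsGroebnerBasis (r : sigmaZ → sigmaZ → Prop) (I : Ideal S) (G : Finset S) : Prop where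
  mem : ∀ g ∈ G, g ∈ I
  ne_zero : ∀ g ∈ G, g ≠ 0
  exists_divides : ∀ f ∈ I, f ≠ 0 → ∃ g ∈ G, ∃ β α : sigmaZ,
    IsLeadingMonomial r g β ∧ IsLeadingMonomial r f α ∧ Divides β α

/-- A Gröbner basis is reduced if its elements have leading coefficient `1` and no monomial of an
element is divisible by the leading monomial of a different element. -/
structure IsReducedGroebnerBasis (r : sigmaZ → sigmaZ → Prop) (I : Ideal S) (G : Finset S) : Prop
    extends IsGroebnerBasis r I G where
  leadingCoeff : ∀ g ∈ G, ∀ α, IsLeadingMonomial r g α → g.coeff α = 1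
  reduced : ∀ g ∈ G, ∀ h ∈ G, h ≠ g → ∀ β, IsLeadingMonomial r h β →
    ∀ γ ∈ g.coeff.support, ¬ Divides β γ

/-- The marked basis attached to `G`: the pairs of an element and its leading monomial. -/
def marked (r : sigmaZ → sigmaZ → Prop) (G : Finset S) : Set (S × sigmaZ) :=
  {p | p.1 ∈ G ∧ IsLeadingMonomial r p.1 p.2}

/-- The cone `C_𝔾` of all `w ∈ σ` such that `(α - β) · w ≥ 0` for every `(g, α)` in the marked
basis `𝔾` and every monomial `β` of `g`. -/
def cone (M : Set (S × sigmaZ)) : PointedCone ℝ (ℝ × ℝ) where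
  carrier := {w | w ∈ sigma ∧ ∀ p ∈ M, ∀ β ∈ p.1.coeff.support,
    0 ≤ dot w ((p.2 : ℤ × ℤ) - (β : ℤ × ℤ))}
  zero_mem' := ⟨zero_mem _, fun p _ β _ => by simp [dot]⟩
  add_mem' := by
    rintro w w' ⟨h, h1⟩ ⟨h', h1'⟩
    refine ⟨add_mem h h', fun p hp β hβ => ?_⟩
    rw [dot_add_left]
    exact add_nonneg (h1 p hp β hβ) (h1' p hp β hβ)
  smul_mem' := by
    rintro c w ⟨h, h1⟩
    refine ⟨Submodule.smul_mem _ c h, fun p hp β hβ => ?_⟩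
    change 0 ≤ dot ((c : ℝ) • w) _
    rw [dot_smul_left]
    exact mul_nonneg c.2 (h1 p hp β hβ)

/-- The monomial ordering `β ≼ α` on `S` associated to the matrix with rows `(2, -1)`, `(1, 1)`:
compare the values of `(2, -1) · _`, and break ties with `(1, 1) · _`. -/
def mle (β α : sigmaZ) : Prop :=
  dot (2, -1) β < dot (2, -1) α ∨
    (dot (2, -1) β = dot (2, -1) α ∧ dot (1, 1) β ≤ dot (1, 1) α)

/-! ### The Gröbner fan -/

open Classical in
/-- The initial form `in_w(f)`: the part of `f` of maximal `w`-weight (and `in_w(0) = 0`). -/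
def initialForm (w : ℝ × ℝ) (f : S) : S :=
  AddMonoidAlgebra.ofCoeff
    (f.coeff.filter fun β => ∀ γ ∈ f.coeff.support, dot w (γ : ℤ × ℤ) ≤ dot w (β : ℤ × ℤ))

/-- The initial ideal `in_w(I)`. -/
def initialIdeal (w : ℝ × ℝ) (I : Ideal S) : Ideal S := Ideal.span (initialForm w '' (I : Set S))

/-- The equivalence class `C[w]` of `w` in `σ`. -/
def weightClass (I : Ideal S) (w : ℝ × ℝ) : Set (ℝ × ℝ) :=
  {w' | w' ∈ sigma ∧ initialIdeal w' I = initialIdeal w I}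

/-- The Gröbner fan of `I`: the closures of the classes `C[w]`, `w ∈ σ`. -/
def groebnerFan (I : Ideal S) : Set (Set (ℝ × ℝ)) :=
  {C | ∃ w ∈ sigma, C = closure (weightClass I w)}

/-! ### Dimension and rays of cones -/

/-- The dimension of a cone: that of its linear span. -/
def coneDim (C : PointedCone ℝ (ℝ × ℝ)) : ℕ :=
  Module.finrank ℝ (Submodule.span ℝ (C : Set (ℝ × ℝ)))

/-- A ray of a cone is a one-dimensional face. -/
def IsRay (C L : PointedCone ℝ (ℝ × ℝ)) : Prop := L.IsFaceOf C ∧ coneDim L = 1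

/-- The half-line `ℝ_{≥0} v`. -/
def halfLine (v : ℝ × ℝ) : PointedCone ℝ (ℝ × ℝ) := PointedCone.hull ℝ {v}

/-- The vector `l_n`. -/
def l (n : ℕ) : ℝ × ℝ :=
  if Odd n then (2 * (n : ℝ) - 2, -(n : ℝ) + 2) else (2 * (n : ℝ), -(n : ℝ) + 1)

end A3Nash

end

/-!
In the lattice coordinates `lev (a, b) = 2a - b` and `row (a, b) = b - a` the semigroup `σ_ℤ` is
`{2 |row| ≤ lev}`, and the ordering `≼` is the lexicographic one. An element `∑ c_a u^a` of `J n`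
satisfies `∑ c_a p(a) = 0` for each polynomial function `p` of degree at most `n` on the lattice
(`moment_eq_zero_of_mem_pow`), which relates `J n` to interpolation of degree `n` at lattice points.

Let the standard exponents be those of level at most `n`, together with those of level `n + 1` and
negative row; they form an initial segment of `≼`. The successive rows `0, -1, 1, -2, 2, …` contain
`n + 1, n, …, 1` standard exponents, a configuration on which interpolation of degree `n` is
uniquely solvable. Hence no nonzero element of `J n` is a combination of standard monomials
(`eq_zero_of_mem_J_of_std`), and conversely products of powers of `u - 1`, `u³v⁴ - 1` and `uv - 1`
rewrite every monomial, row by row, as such a combination (`mon_mem_reducible`). The leading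
monomials of `J n` are therefore the nonstandard ones, and the unique reduced Gröbner basis consists
of the elements `nf n a`, the monomial `a` minus its normal form, for the minimal nonstandard `a`.

A weight is determined by its values `wlev` and `wrow` on the two coordinate vectors. The estimates
`0 ≤ wrow` and `slope n * wrow ≤ 2 * wlev` imply those of the cone by an estimate of the exponent
differences (`nf_support_bound`), and they are implied by them because two specific coefficients of
normal forms are nonzero, as explicit products of affine functions show (`mem_support_nf_top`,
`mem_support_nf_bot`). In the interior of the cone the initial ideal is the ideal of nonstandard
monomials, and it is not outside the cone, so the cone is the closure of an equivalence class of
weights. The rays are read off from the two inequalities.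
-/

noncomputable section

namespace A3Nash

/-! ### Polynomial functions on the lattice and their moments -/

/-- The function `p` is polynomial of degree less than `d`, in the sense that all its `d`-fold
differences vanish. -/
def DegLT : ℕ → (ℤ × ℤ → ℂ) → Prop
  | 0, p => ∀ a, p a = 0
  | d + 1, p => ∀ e, DegLT d fun a => p (a + e) - p a

/-- Affine functions with complex coefficients. -/
def IsAffine (q : ℤ × ℤ → ℂ) : Prop := ∃ u v w : ℂ, ∀ a, q a = u * a.1 + v * a.2 + w

lemma DegLT.add {d : ℕ} {p q : ℤ × ℤ → ℂ} (hp : DegLT d p) (hq : DegLT d q) :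
    DegLT d fun a => p a + q a := by
  induction d generalizing p q with
  | zero => intro a; simp [hp a, hq a]
  | succ d ih =>
    intro e
    convert ih (hp e) (hq e) using 2
    ring

lemma DegLT.const_mul {d : ℕ} {p : ℤ × ℤ → ℂ} (c : ℂ) (hp : DegLT d p) :
    DegLT d fun a => c * p a := by
  induction d generalizing p with
  | zero => intro a; simp [hp a]
  | succ d ih =>
    intro e
    convert ih (hp e) using 2
    ring

lemma DegLT.comp_add {d : ℕ} {p : ℤ × ℤ → ℂ} (b : ℤ × ℤ) (hp : DegLT d p) :
    DegLT d fun a => p (a + b) := by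
  induction d generalizing p with
  | zero => intro a; exact hp _
  | succ d ih =>
    intro e
    convert ih (hp e) using 2 with a
    rw [add_right_comm]

lemma DegLT.affine_mul {d : ℕ} {p q : ℤ × ℤ → ℂ} (hq : IsAffine q) (hp : DegLT d p) :
    DegLT (d + 1) fun a => q a * p a := by
  obtain ⟨u, v, w, hq⟩ := hq
  induction d generalizing p with
  | zero => intro e a; simp only [hp _, mul_zero, sub_zero]
  | succ d ih =>
    intro e
    -- the Leibniz rule for the difference operator
    convert (ih (hp e)).add ((hp.comp_add e).const_mul (u * e.1 + v * e.2)) using 2 with a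
    simp only [hq, Prod.fst_add, Prod.snd_add]
    push_cast
    ring

lemma degLT_one : DegLT 1 fun _ => 1 := by
  intro e a
  simp

lemma DegLT.prod_mul {ι : Type*} (s : Finset ι) (q : ι → ℤ × ℤ → ℂ) (hq : ∀ i, IsAffine (q i))
    {d : ℕ} {p : ℤ × ℤ → ℂ} (hp : DegLT d p) :
    DegLT (s.card + d) fun a => (∏ i ∈ s, q i a) * p a := by
  classical
  induction s using Finset.induction_on with
  | empty => simpa using hp
  | insert i s hi ih =>
    rw [Finset.card_insert_of_notMem hi, add_right_comm]
    convert ih.affine_mul (hq i) using 2 with a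
    rw [Finset.prod_insert hi, mul_assoc]

lemma DegLT.mono {d : ℕ} {p : ℤ × ℤ → ℂ} (hp : DegLT d p) {d' : ℕ} (h : d ≤ d') :
    DegLT d' p := by
  induction h with
  | refl => exact hp
  | step _ ih => simpa using ih.affine_mul (q := fun _ => 1) ⟨0, 0, 1, by simp⟩

/-- The functional on `S` sending the monomial with exponent `a` to `p a`. -/
def moment (p : ℤ × ℤ → ℂ) : S →ₗ[ℂ] ℂ :=
  (Finsupp.linearCombination ℂ fun a : sigmaZ => p a) ∘ₗ
    (AddMonoidAlgebra.coeffLinearEquiv ℂ).toLinearMap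

lemma moment_apply (p : ℤ × ℤ → ℂ) (f : S) :
    moment p f = ∑ a ∈ f.coeff.support, f.coeff a * p a := rfl

/-- The monomial of `S` with exponent `a`. -/
def mon (a : sigmaZ) : S := AddMonoidAlgebra.single a 1

lemma mon_mul_mon (a b : sigmaZ) : mon a * mon b = mon (a + b) := by
  simp [mon, AddMonoidAlgebra.single_mul_single]

lemma mon_zero : mon 0 = 1 := rfl

@[simp] lemma coeff_mon (a : sigmaZ) : (mon a).coeff = Finsupp.single a 1 := rfl

lemma moment_mon (p : ℤ × ℤ → ℂ) (a : sigmaZ) : moment p (mon a) = p a := by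
  simp [moment, mon, AddMonoidAlgebra.coeffLinearEquiv]

/-- The moments of a multiple of `u^e - 1` are moments of the cofactor for a function of lower
degree. -/
lemma moment_mul_sub_one (p : ℤ × ℤ → ℂ) (f : S) (e : sigmaZ) :
    moment p (f * (mon e - 1)) = moment (fun a => p (a + e) - p a) f := by
  have : moment p ∘ₗ LinearMap.mulRight ℂ (mon e - 1) = moment fun a => p (a + e) - p a := by
    refine AddMonoidAlgebra.lhom_ext' fun a => LinearMap.ext_ring ?_
    change moment p (mon a * (mon e - 1)) = moment (fun a => p (a + e) - p a) (mon a)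
    rw [mul_sub, mon_mul_mon, mul_one, map_sub, moment_mon, moment_mon, moment_mon]
    rfl
  exact LinearMap.congr_fun this f

lemma support_nonempty {f : S} (hf : f ≠ 0) : f.coeff.support.Nonempty :=
  Finsupp.support_nonempty_iff.2 fun h => hf (AddMonoidAlgebra.coeff_eq_zero.1 h)

/-- The maximal ideal of the point `(1, 1, 1)` of the surface. -/
def maxI : Ideal S := Ideal.span {xu - 1, xu3v4 - 1, xuv - 1}

lemma moment_eq_zero_of_mem_pow {d : ℕ} {p : ℤ × ℤ → ℂ} (hp : DegLT d p) {f : S}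
    (hf : f ∈ maxI ^ d) : moment p f = 0 := by
  induction d generalizing p f with
  | zero =>
    rw [moment_apply]
    exact Finset.sum_eq_zero fun a _ => by rw [hp, mul_zero]
  | succ d ih =>
    rw [pow_succ] at hf
    refine Submodule.mul_induction_on hf (fun g hg h hh => ?_) fun x y hx hy => by
      rw [map_add, hx, hy, add_zero]
    refine Submodule.span_induction (p := fun h _ => ∀ g ∈ maxI ^ d, moment p (g * h) = 0)
      ?_ ?_ ?_ ?_ hh g hg
    · rintro _ (rfl | rfl | rfl) g hg <;>
      · exact (moment_mul_sub_one p g _).trans (ih (hp _) hg)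
    · simp
    · intro x y _ _ hx hy g hg
      rw [mul_add, map_add, hx g hg, hy g hg, add_zero]
    · intro s x _ hx g hg
      rw [smul_eq_mul, ← mul_assoc]
      exact hx _ (Ideal.mul_mem_right _ _ hg)

/-- A function of degree at most `n` vanishing at all but one monomial of an element of `J n` also
vanishes at the remaining one. -/
lemma coeff_eq_zero_of_degLT {n : ℕ} {f : S} (hf : f ∈ J n) {p : ℤ × ℤ → ℂ}
    (hp : DegLT (n + 1) p) {a : sigmaZ} (ha : p a ≠ 0)
    (h : ∀ b ∈ f.coeff.support, b ≠ a → p b = 0) : f.coeff a = 0 := by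
  have h0 := moment_eq_zero_of_mem_pow hp hf
  rw [moment_apply, Finset.sum_eq_single a (fun b hb hne => by rw [h b hb hne, mul_zero])
    (fun hna => by rw [Finsupp.notMem_support_iff.1 hna, zero_mul])] at h0
  exact (mul_eq_zero.1 h0).resolve_right ha

/-! ### The standard monomials -/

/-- The level of a lattice point: its `(2, -1)`-weight. -/
def lev (a : ℤ × ℤ) : ℤ := 2 * a.1 - a.2

/-- The row of a lattice point. Together with the level it is a system of coordinates, in which
the semigroup is given by `2 * |row| ≤ lev`. -/
def row (a : ℤ × ℤ) : ℤ := a.2 - a.1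

@[simp] lemma lev_zero : lev 0 = 0 := rfl
@[simp] lemma row_zero : row 0 = 0 := rfl

lemma lev_add (a b : ℤ × ℤ) : lev (a + b) = lev a + lev b := by
  simp only [lev, Prod.fst_add, Prod.snd_add]; ring

lemma row_add (a b : ℤ × ℤ) : row (a + b) = row a + row b := by
  simp only [row, Prod.fst_add, Prod.snd_add]; ring

lemma mem_sigmaZ_iff {a : ℤ × ℤ} : a ∈ sigmaZ ↔ 2 * |row a| ≤ lev a := by
  rw [mem_sigmaZ]
  simp only [lev, row]
  rcases abs_cases (a.2 - a.1) with ⟨h, _⟩ | ⟨h, _⟩ <;> rw [h] <;> omega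

lemma sigmaZ_bound (a : sigmaZ) : 2 * |row a| ≤ lev a := mem_sigmaZ_iff.1 a.2

lemma sigmaZ_bounds (a : sigmaZ) : 2 * row a ≤ lev a ∧ -(2 * row a) ≤ lev a := by
  have := sigmaZ_bound a
  have := abs_le.1 (show |row a| ≤ |row a| from le_rfl)
  omega

/-- The point of the semigroup with given level and row. -/
def pt (k t : ℤ) (h : 2 * t ≤ k ∧ -(2 * t) ≤ k) : sigmaZ :=
  ⟨(k + t, k + 2 * t), by rw [mem_sigmaZ]; dsimp only; omega⟩

@[simp] lemma lev_pt {k t : ℤ} (h) : lev (pt k t h) = k := by simp only [lev, pt]; ring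
@[simp] lemma row_pt {k t : ℤ} (h) : row (pt k t h) = t := by simp only [row, pt]; ring

lemma ext_lev_row {a b : sigmaZ} (h : lev a = lev b) (h' : row a = row b) : a = b := by
  simp only [lev, row] at h h'
  ext <;> omega

/-- The standard exponents for `J n`: those of level at most `n`, and those of level `n + 1` and
negative row. -/
def Std (n : ℕ) (a : sigmaZ) : Prop := lev a ≤ n ∨ lev a = n + 1 ∧ row a < 0

lemma isAffine_lev_sub (c : ℤ) : IsAffine fun a => ((lev a - c : ℤ) : ℂ) :=
  ⟨2, -1, -c, fun a => by simp only [lev]; push_cast; ring⟩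

lemma isAffine_row_sub (c : ℤ) : IsAffine fun a => ((row a - c : ℤ) : ℂ) :=
  ⟨-1, 1, -c, fun a => by simp only [row]; push_cast; ring⟩

/-- The rows `0, -1, 1, -2, 2, …` that precede the row `r` in this enumeration. -/
def rowsBefore (r : ℤ) : Finset ℤ := if 0 ≤ r then Finset.Ico (-r) r else Finset.Ioo r (-r)

/-- The position of a row in the enumeration `0, -1, 1, -2, 2, …`. -/
def rowIndex (r : ℤ) : ℤ := if 0 ≤ r then 2 * r else -2 * r - 1

lemma mem_rowsBefore {r s : ℤ} (h : rowIndex s ≤ rowIndex r) (hne : s ≠ r) :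
    s ∈ rowsBefore r := by
  unfold rowIndex at h
  unfold rowsBefore
  split_ifs at * <;> simp only [Finset.mem_Ico, Finset.mem_Ioo] <;> omega

/-- The levels of the standard exponents in the row `r`. -/
def levels (n : ℕ) (r : ℤ) : Finset ℤ :=
  if 0 ≤ r then Finset.Icc (2 * r) n else Finset.Icc (-2 * r) (n + 1)

lemma lev_mem_levels {n : ℕ} {a : sigmaZ} (ha : Std n a) : lev a ∈ levels n (row a) := by
  have := sigmaZ_bounds a
  unfold levels
  unfold Std at ha
  split_ifs <;> rw [Finset.mem_Icc] <;> omega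

/-- The row at position `i` of the enumeration contains exactly `n + 1 - i` standard exponents. -/
lemma card_rowsBefore_add_card_levels {n : ℕ} {r k : ℤ} (hk : k ∈ levels n r) :
    (rowsBefore r).card + ((levels n r).erase k).card = n := by
  rw [Finset.card_erase_of_mem hk]
  unfold levels at *
  unfold rowsBefore
  split_ifs at * <;> rw [Finset.mem_Icc] at hk <;>
    simp only [Int.card_Icc, Int.card_Ico, Int.card_Ioo] <;> omega

/-- No nonzero element of `J n` is a combination of standard monomials: the standard exponents lie
on `n + 1` parallel lines, with `n + 1, n, …, 1` points on the successive lines, so that products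
of affine functions separate the last point occurring in the support from the others. -/
lemma eq_zero_of_mem_J_of_std {n : ℕ} {f : S} (hf : f ∈ J n)
    (h : ∀ b ∈ f.coeff.support, Std n b) : f = 0 := by
  by_contra hne
  obtain ⟨a, ha, hmax⟩ := Finset.exists_max_image f.coeff.support (fun b => rowIndex (row b))
    (support_nonempty hne)
  refine Finsupp.mem_support_iff.1 ha ?_
  have hdeg := (degLT_one.prod_mul ((levels n (row a)).erase (lev a)) _ isAffine_lev_sub).prod_mul
    (rowsBefore (row a)) _ isAffine_row_sub
  rw [← add_assoc, card_rowsBefore_add_card_levels (lev_mem_levels (h a ha))] at hdeg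
  refine coeff_eq_zero_of_degLT hf hdeg ?_ fun b hb hba => ?_
  · simp only [mul_one]
    refine mul_ne_zero (Finset.prod_ne_zero_iff.2 fun c hc => ?_)
      (Finset.prod_ne_zero_iff.2 fun c hc => ?_)
    · rw [Int.cast_ne_zero]
      unfold rowsBefore at hc
      split_ifs at hc <;> simp only [Finset.mem_Ico, Finset.mem_Ioo] at hc <;> omega
    · rw [Int.cast_ne_zero, sub_ne_zero]
      exact (Finset.ne_of_mem_erase hc).symm
  · rw [mul_one]
    by_cases hr : row b = row a
    · have hl : lev b ≠ lev a := fun hl => hba (ext_lev_row hl hr)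
      rw [Finset.prod_eq_zero (i := lev b) (s := Finset.erase _ _)
        (Finset.mem_erase.2 ⟨hl, hr ▸ lev_mem_levels (h b hb)⟩) (by simp), mul_zero]
    · rw [Finset.prod_eq_zero (mem_rowsBefore (hmax b hb) hr) (by simp), zero_mul]

/-! ### Standard monomials span the quotient -/

/-- The elements of `S` supported on the rows between `lo` and `hi`. -/
def rowsBetween (lo hi : ℤ) : Submodule ℂ S :=
  AddMonoidAlgebra.supported ℂ ℂ {a : sigmaZ | lo ≤ row a ∧ row a ≤ hi}

/-- The elements of `S` congruent modulo `J n` to a combination of standard monomials. -/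
def reducible (n : ℕ) : Submodule ℂ S :=
  AddMonoidAlgebra.supported ℂ ℂ {a : sigmaZ | Std n a} ⊔ (J n).restrictScalars ℂ

lemma supported_le_iff {s : Set sigmaZ} {P : Submodule ℂ S} :
    AddMonoidAlgebra.supported ℂ ℂ s ≤ P ↔ ∀ a ∈ s, mon a ∈ P := by
  rw [AddMonoidAlgebra.supported_eq_span_single, Submodule.span_le, Set.image_subset_iff]
  rfl

lemma mon_mem_supported {s : Set sigmaZ} {a : sigmaZ} (ha : a ∈ s) :
    mon a ∈ AddMonoidAlgebra.supported ℂ ℂ s :=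
  supported_le_iff.1 le_rfl a ha

lemma mon_mem_rowsBetween {lo hi : ℤ} {a : sigmaZ} (h : lo ≤ row a ∧ row a ≤ hi) :
    mon a ∈ rowsBetween lo hi := mon_mem_supported h

lemma rowsBetween_mono {lo hi lo' hi' : ℤ} (h : lo' ≤ lo) (h' : hi ≤ hi') :
    rowsBetween lo hi ≤ rowsBetween lo' hi' :=
  AddMonoidAlgebra.supported_mono fun _ ha => ⟨h.trans ha.1, ha.2.trans h'⟩

lemma mon_mul_mem_rowsBetween {lo hi lo' hi' : ℤ} {f : S} (hf : f ∈ rowsBetween lo hi)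
    {a : sigmaZ} (h : lo' ≤ row a + lo) (h' : row a + hi ≤ hi') :
    mon a * f ∈ rowsBetween lo' hi' := by
  have : rowsBetween lo hi ≤ (rowsBetween lo' hi').comap (LinearMap.mulLeft ℂ (mon a)) := by
    refine supported_le_iff.2 fun b hb => ?_
    change mon a * mon b ∈ rowsBetween lo' hi'
    rw [mon_mul_mon]
    have hr : row ((a + b : sigmaZ) : ℤ × ℤ) = row a + row b := row_add a b
    have := hb.1
    have := hb.2
    exact mon_mem_rowsBetween (by omega)
  exact this hf

lemma neg_one_pow_mul_mem {P : Submodule ℂ S} {f : S} (j : ℕ) (hf : f ∈ P) :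
    (-1) ^ j * f ∈ P := by
  rcases neg_one_pow_eq_or S j with h | h <;> rw [h]
  · simpa using hf
  · simpa using hf

lemma xu_eq : xu = mon (pt 2 (-1) (by norm_num)) := rfl
lemma xu3v4_eq : xu3v4 = mon (pt 2 1 (by norm_num)) := rfl
lemma xuv_eq : xuv = mon (pt 1 0 (by norm_num)) := rfl

/-- The power `u^j`. -/
def powX (j : ℕ) : sigmaZ := pt (2 * j) (-j) (by omega)

/-- The power `(u³v⁴)^j`. -/
def powY (j : ℕ) : sigmaZ := pt (2 * j) j (by omega)

@[simp] lemma lev_powX (j : ℕ) : lev (powX j) = 2 * j := lev_pt _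
@[simp] lemma row_powX (j : ℕ) : row (powX j) = -j := row_pt _
@[simp] lemma lev_powY (j : ℕ) : lev (powY j) = 2 * j := lev_pt _
@[simp] lemma row_powY (j : ℕ) : row (powY j) = j := row_pt _

/-- The element `(u - 1)(u³v⁴ - 1)`, which lies in the rows `-1, 0, 1`. -/
def xy : S := (xu - 1) * (xu3v4 - 1)

lemma xu_mem : xu - 1 ∈ maxI := Ideal.subset_span (by simp)
lemma xu3v4_mem : xu3v4 - 1 ∈ maxI := Ideal.subset_span (by simp)
lemma xuv_mem : xuv - 1 ∈ maxI := Ideal.subset_span (by simp)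

lemma xy_pow_mem (j : ℕ) : xy ^ j ∈ maxI ^ (2 * j) := by
  rw [pow_mul, pow_two]
  exact Ideal.pow_mem_pow (Ideal.mul_mem_mul xu_mem xu3v4_mem) j

lemma xy_eq : xy = mon (pt 4 0 (by norm_num)) + 1 - xu - xu3v4 := by
  have : xu * xu3v4 = mon (pt 4 0 (by norm_num)) := by
    rw [xu_eq, xu3v4_eq, mon_mul_mon]; rfl
  rw [xy, ← this]; ring

lemma xu_mul_powX (j : ℕ) : xu * mon (powX j) = mon (powX (j + 1)) := by
  rw [xu_eq, mon_mul_mon]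
  congr 1
  apply ext_lev_row
  · rw [AddSubmonoid.coe_add, lev_add]; simp; ring
  · rw [AddSubmonoid.coe_add, row_add]; simp

lemma xu3v4_mul_powY (j : ℕ) : xu3v4 * mon (powY j) = mon (powY (j + 1)) := by
  rw [xu3v4_eq, mon_mul_mon]
  congr 1
  apply ext_lev_row
  · rw [AddSubmonoid.coe_add, lev_add]; simp; ring
  · rw [AddSubmonoid.coe_add, row_add]; simp; ring

/-- The extremal rows of `xy ^ (j + 1)`. -/
lemma xy_pow_sub_mem (j : ℕ) :
    xy ^ (j + 1) - (-1) ^ (j + 1) * (mon (powX (j + 1)) + mon (powY (j + 1))) ∈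
      rowsBetween (-j) j := by
  induction j with
  | zero =>
    have h : xy ^ (0 + 1) - (-1) ^ (0 + 1) * (mon (powX (0 + 1)) + mon (powY (0 + 1))) =
        mon (pt 4 0 (by norm_num)) + mon 0 := by
      rw [← xu_mul_powX, ← xu3v4_mul_powY, xy_eq, mon_zero,
        show mon (powX 0) = 1 from rfl, show mon (powY 0) = 1 from rfl]
      ring
    rw [h]
    exact add_mem (mon_mem_rowsBetween (by simp)) (mon_mem_rowsBetween (by simp))
  | succ j ih =>
    set X := mon (powX (j + 1))
    set Y := mon (powY (j + 1))
    have hX : X ∈ rowsBetween (-(j + 1 : ℕ)) (-(j + 1 : ℕ)) := mon_mem_rowsBetween (by simp)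
    have hY : Y ∈ rowsBetween (j + 1 : ℕ) (j + 1 : ℕ) := mon_mem_rowsBetween (by simp)
    have hm : ∀ (a : sigmaZ) {f lo hi}, f ∈ rowsBetween lo hi → -(j + 1 : ℕ) ≤ row a + lo →
        row a + hi ≤ (j + 1 : ℕ) → mon a * f ∈ rowsBetween (-(j + 1 : ℕ)) (j + 1 : ℕ) :=
      fun a f lo hi hf h h' => mon_mul_mem_rowsBetween hf h h'
    set r := xy ^ (j + 1) - (-1) ^ (j + 1) * (X + Y) with hr
    have h : xy ^ (j + 1 + 1) - (-1) ^ (j + 1 + 1) * (mon (powX (j + 1 + 1)) +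
        mon (powY (j + 1 + 1))) =
        mon (pt 4 0 (by norm_num)) * r + mon 0 * r - mon (pt 2 (-1) (by norm_num)) * r
          - mon (pt 2 1 (by norm_num)) * r
          + (-1) ^ (j + 1) * (mon (pt 4 0 (by norm_num)) * X + mon 0 * X
            + mon (pt 4 0 (by norm_num)) * Y + mon 0 * Y
            - mon (pt 2 (-1) (by norm_num)) * Y - mon (pt 2 1 (by norm_num)) * X) := by
      rw [← xu_mul_powX, ← xu3v4_mul_powY, pow_succ xy, ← xu_eq, ← xu3v4_eq, mon_zero, hr]
      nth_rw 2 [xy_eq]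
      ring
    rw [h]
    refine add_mem (sub_mem (sub_mem (add_mem ?_ ?_) ?_) ?_) (neg_one_pow_mul_mem _
      (sub_mem (sub_mem (add_mem (add_mem (add_mem ?_ ?_) ?_) ?_) ?_) ?_))
    · exact hm _ ih (by simp) (by simp)
    · exact hm _ ih (by simp) (by simp)
    · exact hm _ ih (by simp) (by simp; omega)
    · exact hm _ ih (by simp) (by simp; omega)
    · exact hm _ hX (by simp) (by simp; omega)
    · exact hm _ hX (by simp) (by simp; omega)
    · exact hm _ hY (by simp; omega) (by simp)
    · exact hm _ hY (by simp; omega) (by simp)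
    · exact hm _ hY (by simp; omega) (by simp)
    · exact hm _ hX (by simp) (by simp; omega)

lemma sub_one_mul_xy_pow_sub_mem (j : ℕ) :
    (xu - 1) * xy ^ j - (-1) ^ j * mon (powX (j + 1)) ∈ rowsBetween (-j) j := by
  rw [← xu_mul_powX]
  cases j with
  | zero =>
    have h : (xu - 1) * xy ^ 0 - (-1) ^ 0 * (xu * mon (powX 0)) = -mon 0 := by
      rw [mon_zero, show mon (powX 0) = 1 from rfl]; ring
    rw [h]
    exact neg_mem (mon_mem_rowsBetween (by simp))
  | succ j =>
    have ih := xy_pow_sub_mem j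
    set X := mon (powX (j + 1))
    set Y := mon (powY (j + 1))
    have hX : X ∈ rowsBetween (-(j + 1 : ℕ)) (-(j + 1 : ℕ)) := mon_mem_rowsBetween (by simp)
    have hY : Y ∈ rowsBetween (j + 1 : ℕ) (j + 1 : ℕ) := mon_mem_rowsBetween (by simp)
    set r := xy ^ (j + 1) - (-1) ^ (j + 1) * (X + Y) with hr
    have h : (xu - 1) * xy ^ (j + 1) - (-1) ^ (j + 1) * (xu * X) =
        mon (pt 2 (-1) (by norm_num)) * r - mon 0 * r
          + (-1) ^ (j + 1) * (mon (pt 2 (-1) (by norm_num)) * Y - X - Y) := by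
      rw [← xu_eq, mon_zero, hr]
      ring
    rw [h]
    refine add_mem (sub_mem ?_ ?_) (neg_one_pow_mul_mem _ (sub_mem (sub_mem ?_ ?_) ?_))
    · exact mon_mul_mem_rowsBetween ih (by simp) (by simp; omega)
    · exact mon_mul_mem_rowsBetween ih (by simp) (by simp)
    · exact mon_mul_mem_rowsBetween hY (by simp; omega) (by simp)
    · exact rowsBetween_mono le_rfl (by omega) hX
    · exact rowsBetween_mono (by omega) le_rfl hY

lemma xuv_pow_mul_mem {lo hi : ℤ} {f : S} (hf : f ∈ rowsBetween lo hi) (d : ℕ) :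
    xuv ^ d * f ∈ rowsBetween lo hi := by
  induction d with
  | zero => simpa using hf
  | succ d ih =>
    rw [pow_succ', mul_assoc, xuv_eq]
    exact mon_mul_mem_rowsBetween ih (by simp) (by simp)

lemma xuv_sub_one_pow_mul_mem {lo hi : ℤ} {f : S} (hf : f ∈ rowsBetween lo hi) (d : ℕ) :
    (xuv - 1) ^ d * f ∈ rowsBetween lo hi := by
  induction d with
  | zero => simpa using hf
  | succ d ih =>
    rw [pow_succ', mul_assoc, sub_mul, one_mul]
    exact sub_mem (by simpa using xuv_pow_mul_mem ih 1) ih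

/-- The powers of `z` below the `d`-th reduce `z ^ d` to a multiple of `(z - 1) ^ e`. -/
lemma pow_sub_mem_span {R : Type*} [CommRing R] [Algebra ℂ R] (z : R) (e d : ℕ) (h : e ≤ d) :
    z ^ d - z ^ (d - e) * (z - 1) ^ e ∈ Submodule.span ℂ ((fun i => z ^ i) '' Set.Iio d) := by
  induction e generalizing d with
  | zero => simp
  | succ e ih =>
    obtain ⟨c, rfl⟩ := Nat.exists_eq_add_of_le h
    have h1 := ih (e + 1 + c) (by omega)
    have h2 := ih (e + c) (by omega)
    rw [show e + 1 + c - e = c + 1 by omega] at h1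
    rw [show e + c - e = c by omega] at h2
    rw [show e + 1 + c - (e + 1) = c by omega]
    have h3 : z ^ (e + c) ∈ Submodule.span ℂ ((fun i => z ^ i) '' Set.Iio (e + 1 + c)) :=
      Submodule.subset_span ⟨e + c, by simp only [Set.mem_Iio]; omega, rfl⟩
    have h4 := Submodule.span_mono (R := ℂ) (Set.image_mono (f := fun i => z ^ i)
      (Set.Iio_subset_Iio (show e + c ≤ e + 1 + c by omega))) h2
    convert sub_mem (add_mem h1 h3) h4 using 1
    ring

/-- Suppose that the monomial `a` agrees up to sign with an element of `maxI ^ i` modulo elements of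
other rows that are all known to be reducible. If the first `n + 1 - i` multiples of `a` by powers
of `uv` are reducible, then all are. -/
lemma mon_mul_xuv_pow_mem_reducible {n i : ℕ} {lo hi : ℤ} (hR : rowsBetween lo hi ≤ reducible n)
    {ν : S} (hν : ν ∈ maxI ^ i) {j : ℕ} {a : sigmaZ}
    (h : ν - (-1) ^ j * mon a ∈ rowsBetween lo hi)
    (ha : ∀ d, d + i < n + 1 → mon a * xuv ^ d ∈ reducible n) (d : ℕ) :
    mon a * xuv ^ d ∈ reducible n := by
  induction d using Nat.strong_induction_on with
  | _ d ih =>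
    by_cases hd : d + i < n + 1
    · exact ha d hd
    set e := n + 1 - i with he
    have hed : e ≤ d := by omega
    have h1 : xuv ^ (d - e) * ((xuv - 1) ^ e * ν) ∈ reducible n := by
      refine Submodule.mem_sup_right ?_
      refine Ideal.mul_mem_left _ _ ?_
      refine Ideal.pow_le_pow_right (show n + 1 ≤ e + i by omega) ?_
      rw [pow_add]
      exact Ideal.mul_mem_mul (Ideal.pow_mem_pow xuv_mem _) hν
    have h2 := hR (xuv_pow_mul_mem (xuv_sub_one_pow_mul_mem h e) (d - e))
    have h3 : mon a * (xuv ^ d - xuv ^ (d - e) * (xuv - 1) ^ e) ∈ reducible n := by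
      have : Submodule.span ℂ ((fun i => xuv ^ i) '' Set.Iio d) ≤
          (reducible n).comap (LinearMap.mulLeft ℂ (mon a)) := by
        rw [Submodule.span_le]
        rintro _ ⟨l, hl, rfl⟩
        exact ih l hl
      exact this (pow_sub_mem_span xuv e d hed)
    have h4 := add_mem h3 (neg_one_pow_mul_mem j (sub_mem h1 h2))
    have h5 : ((-1) ^ j * (-1) ^ j : S) = 1 := by rw [← mul_pow]; simp
    convert h4 using 1
    linear_combination (-(xuv ^ (d - e) * (xuv - 1) ^ e * mon a)) * h5

lemma mon_mul_xuv_pow (a : sigmaZ) (d : ℕ) :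
    ∃ b : sigmaZ, mon a * xuv ^ d = mon b ∧ lev b = lev a + d ∧ row b = row a := by
  induction d with
  | zero => exact ⟨a, by simp⟩
  | succ d ih =>
    obtain ⟨b, hb, hl, hr⟩ := ih
    refine ⟨b + pt 1 0 (by norm_num), ?_, ?_, ?_⟩
    · rw [pow_succ, ← mul_assoc, hb, xuv_eq, mon_mul_mon]
    · rw [AddSubmonoid.coe_add, lev_add]; simp; omega
    · rw [AddSubmonoid.coe_add, row_add]; simpa using hr

lemma mon_mul_xuv_pow_mem_of_std {n : ℕ} {a : sigmaZ} {d : ℕ}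
    (h : lev a + d ≤ n ∨ lev a + d = n + 1 ∧ row a < 0) : mon a * xuv ^ d ∈ reducible n := by
  obtain ⟨b, hb, hl, hr⟩ := mon_mul_xuv_pow a d
  rw [hb]
  exact Submodule.mem_sup_left (mon_mem_supported (show Std n b by unfold Std; omega))

lemma eq_mul_xuv_pow {a b : sigmaZ} (hr : row b = row a) (hl : lev a ≤ lev b) :
    mon b = mon a * xuv ^ (lev b - lev a).toNat := by
  obtain ⟨c, hc, hl', hr'⟩ := mon_mul_xuv_pow a (lev b - lev a).toNat
  rw [hc, ext_lev_row (a := b) (b := c) (by omega) (by omega)]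

/-- Every element of `S` is congruent modulo `J n` to a combination of standard monomials: the
rows `0, -1, 1, -2, 2, …` are dealt with one after the other, the row at position `i` being the
last row occurring in an element of `maxI ^ i`. -/
lemma rowsBetween_le_reducible (n j : ℕ) : rowsBetween (-j) j ≤ reducible n := by
  induction j with
  | zero =>
    refine supported_le_iff.2 fun a ha => ?_
    have ha : (-(0 : ℕ) : ℤ) ≤ row a ∧ row a ≤ (0 : ℕ) := ha
    have hb := sigmaZ_bounds a
    have h0 : lev ((0 : sigmaZ) : ℤ × ℤ) = 0 := rfl
    have h0' : row ((0 : sigmaZ) : ℤ × ℤ) = 0 := rfl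
    rw [eq_mul_xuv_pow (a := 0) (b := a) (by omega) (by omega)]
    refine mon_mul_xuv_pow_mem_reducible (i := 0) (lo := 1) (hi := 0) (ν := 1) (j := 0) ?_ (by simp)
      (by simp [mon_zero]) (fun d hd => mon_mul_xuv_pow_mem_of_std (by omega)) _
    exact supported_le_iff.2 fun a ha => by have := ha.1; have := ha.2; omega
  | succ j ih =>
    have hX : ∀ a : sigmaZ, row a = -(j + 1 : ℕ) → mon a ∈ reducible n := by
      intro a ha
      have hb := sigmaZ_bounds a
      rw [eq_mul_xuv_pow (a := powX (j + 1)) (b := a) (by simp; omega) (by simp; omega)]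
      refine mon_mul_xuv_pow_mem_reducible (i := 2 * j + 1) ih ?_ (sub_one_mul_xy_pow_sub_mem j)
        (fun d hd => mon_mul_xuv_pow_mem_of_std (by simp; omega)) _
      rw [pow_succ']
      exact Ideal.mul_mem_mul xu_mem (xy_pow_mem j)
    have hR : rowsBetween (-(j + 1 : ℕ)) j ≤ reducible n := by
      refine supported_le_iff.2 fun a ha => ?_
      by_cases h : row a = -(j + 1 : ℕ)
      · exact hX a h
      · have := ha.1
        have := ha.2
        exact ih (mon_mem_rowsBetween (by omega))
    refine supported_le_iff.2 fun a ha => ?_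
    have := ha.1
    have := ha.2
    by_cases h : row a = (j + 1 : ℕ)
    · have hb := sigmaZ_bounds a
      rw [eq_mul_xuv_pow (a := powY (j + 1)) (b := a) (by simp; omega) (by simp; omega)]
      refine mon_mul_xuv_pow_mem_reducible (i := 2 * (j + 1)) (j := j + 1) hR
        (xy_pow_mem (j + 1)) ?_
        (fun d hd => mon_mul_xuv_pow_mem_of_std (by simp; omega)) _
      have h1 := rowsBetween_mono (lo' := -(j + 1 : ℕ)) (by omega) le_rfl (xy_pow_sub_mem j)
      have h2 : mon (powX (j + 1)) ∈ rowsBetween (-(j + 1 : ℕ)) j :=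
        mon_mem_rowsBetween (by simp; omega)
      convert add_mem h1 (neg_one_pow_mul_mem (j + 1) h2) using 1
      ring
    · exact hR (mon_mem_rowsBetween (by omega))

lemma mon_mem_reducible (n : ℕ) (a : sigmaZ) : mon a ∈ reducible n :=
  rowsBetween_le_reducible n (row a).natAbs (mon_mem_rowsBetween (by omega))

/-! ### The reduced Gröbner basis -/

lemma exists_mem_J_eq_mon_sub (n : ℕ) (a : sigmaZ) :
    ∃ f ∈ J n, ∀ b, ¬ Std n b → f.coeff b = (mon a).coeff b := by
  obtain ⟨s, hs, f, hf, h⟩ := Submodule.mem_sup.1 (mon_mem_reducible n a)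
  refine ⟨f, hf, fun b hb => ?_⟩
  rw [← h, AddMonoidAlgebra.coeff_add, Finsupp.add_apply,
    AddMonoidAlgebra.mem_supported'.1 hs b hb, zero_add]

/-- The element of `J n` obtained by subtracting from the monomial with exponent `a` its normal
form, a combination of standard monomials. -/
def nf (n : ℕ) (a : sigmaZ) : S := (exists_mem_J_eq_mon_sub n a).choose

lemma nf_mem (n : ℕ) (a : sigmaZ) : nf n a ∈ J n := (exists_mem_J_eq_mon_sub n a).choose_spec.1

lemma coeff_nf {n : ℕ} {b : sigmaZ} (a : sigmaZ) (hb : ¬ Std n b) :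
    (nf n a).coeff b = (mon a).coeff b :=
  (exists_mem_J_eq_mon_sub n a).choose_spec.2 b hb

lemma coeff_nf_self {n : ℕ} {a : sigmaZ} (ha : ¬ Std n a) : (nf n a).coeff a = 1 := by
  rw [coeff_nf a ha, coeff_mon, Finsupp.single_eq_same]

lemma std_of_mem_support_nf {n : ℕ} {a b : sigmaZ} (hb : b ∈ (nf n a).coeff.support)
    (hne : b ≠ a) : Std n b := by
  by_contra h
  rw [Finsupp.mem_support_iff, coeff_nf a h, coeff_mon, Finsupp.single_eq_of_ne hne] at hb
  exact hb rfl

lemma mem_support_nf_self {n : ℕ} {a : sigmaZ} (ha : ¬ Std n a) :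
    a ∈ (nf n a).coeff.support := by
  rw [Finsupp.mem_support_iff, coeff_nf_self ha]
  exact one_ne_zero

lemma eq_of_mem_J {n : ℕ} {f g : S} (hf : f ∈ J n) (hg : g ∈ J n)
    (h : ∀ b, ¬ Std n b → f.coeff b = g.coeff b) : f = g := by
  refine sub_eq_zero.1 (eq_zero_of_mem_J_of_std (sub_mem hf hg) fun b hb => ?_)
  by_contra hs
  rw [Finsupp.mem_support_iff, AddMonoidAlgebra.coeff_sub, Finsupp.sub_apply, h b hs,
    sub_self] at hb
  exact hb rfl

lemma dot_weight (b : ℤ × ℤ) : dot (2, -1) b = (lev b : ℝ) := by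
  simp only [dot, lev]; push_cast; ring

lemma dot_tie (b : ℤ × ℤ) : dot (1, 1) b = 2 * (lev b : ℝ) + 3 * (row b : ℝ) := by
  simp only [dot, lev, row]; push_cast; ring

lemma mle_iff {b a : sigmaZ} : mle b a ↔ lev b < lev a ∨ lev b = lev a ∧ row b ≤ row a := by
  unfold mle
  rw [dot_weight, dot_weight, dot_tie, dot_tie, Int.cast_lt, Int.cast_inj]
  refine or_congr_right (and_congr_right fun h => ?_)
  rw [h, add_le_add_iff_left, mul_le_mul_iff_right₀ (by norm_num), Int.cast_le]

lemma mle_antisymm {b a : sigmaZ} (h : mle b a) (h' : mle a b) : b = a := by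
  rw [mle_iff] at h h'
  exact ext_lev_row (by omega) (by omega)

lemma mle_of_std {n : ℕ} {b a : sigmaZ} (hb : Std n b) (ha : ¬ Std n a) : mle b a := by
  unfold Std at *
  rw [mle_iff]
  omega

lemma isLeadingMonomial_unique {f : S} {a b : sigmaZ} (ha : IsLeadingMonomial mle f a)
    (hb : IsLeadingMonomial mle f b) : a = b :=
  mle_antisymm (hb.2 a ha.1) (ha.2 b hb.1)

lemma exists_isLeadingMonomial {f : S} (hf : f ≠ 0) : ∃ a, IsLeadingMonomial mle f a := by
  obtain ⟨a, ha, h⟩ := Finset.exists_max_image f.coeff.support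
    (fun b => toLex (lev b, row b)) (support_nonempty hf)
  exact ⟨a, ha, fun b hb => mle_iff.2 (Prod.Lex.le_iff.1 (h b hb))⟩

/-- The standard exponents form an initial segment of the ordering, so that they contain no leading
exponent of an element of `J n`. -/
lemma not_std_of_isLeadingMonomial {n : ℕ} {f : S} (hf : f ∈ J n) {a : sigmaZ}
    (ha : IsLeadingMonomial mle f a) : ¬ Std n a := by
  intro hs
  have : f = 0 := eq_zero_of_mem_J_of_std hf fun b hb => by
    by_contra hb'
    exact hb' (mle_antisymm (mle_of_std hs hb') (ha.2 b hb) ▸ hs)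
  simpa [this] using ha.1

lemma isLeadingMonomial_nf {n : ℕ} {a : sigmaZ} (ha : ¬ Std n a) :
    IsLeadingMonomial mle (nf n a) a := by
  refine ⟨mem_support_nf_self ha, fun b hb => ?_⟩
  by_cases h : b = a
  · exact mle_iff.2 (by rw [h]; exact Or.inr ⟨rfl, le_rfl⟩)
  · exact mle_of_std (std_of_mem_support_nf hb h) ha

lemma lev_lt_of_divides {c a : sigmaZ} (h : Divides c a) (hne : c ≠ a) : lev c < lev a := by
  obtain ⟨d, rfl⟩ := h
  rw [AddSubmonoid.coe_add, lev_add]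
  by_contra hlt
  have := sigmaZ_bounds d
  have hd : d = 0 := ext_lev_row (by simp; omega) (by simp; omega)
  simp [hd] at hne

lemma std_of_divides {n : ℕ} {c a : sigmaZ} (h : Divides c a) (ha : Std n a) : Std n c := by
  by_cases hne : c = a
  · rwa [hne]
  have := lev_lt_of_divides h hne
  unfold Std at *
  omega

lemma Divides.refl (a : sigmaZ) : Divides a a := ⟨0, (add_zero a).symm⟩

lemma Divides.trans {a b c : sigmaZ} (h : Divides a b) (h' : Divides b c) : Divides a c := by
  obtain ⟨d, rfl⟩ := h
  obtain ⟨e, rfl⟩ := h'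
  exact ⟨d + e, add_assoc _ _ _⟩

/-- The minimal generators of the monomial ideal of nonstandard monomials. -/
def MinGen (n : ℕ) (a : sigmaZ) : Prop :=
  ¬ Std n a ∧ ∀ c, Divides c a → ¬ Std n c → c = a

lemma exists_minGen_divides {n : ℕ} {a : sigmaZ} (ha : ¬ Std n a) :
    ∃ c, MinGen n c ∧ Divides c a := by
  induction h : (lev a).toNat using Nat.strong_induction_on generalizing a with
  | _ k ih =>
    by_cases hm : MinGen n a
    · exact ⟨a, hm, Divides.refl a⟩
    obtain ⟨b, hb, hbs, hne⟩ : ∃ b, Divides b a ∧ ¬ Std n b ∧ b ≠ a := by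
      by_contra! hc
      exact hm ⟨ha, hc⟩
    have h1 := lev_lt_of_divides hb hne
    have h2 := sigmaZ_bounds b
    obtain ⟨c, hc, hcb⟩ := ih _ (by omega) hbs rfl
    exact ⟨c, hc, hcb.trans hb⟩

lemma MinGen.lev_le {n : ℕ} {a : sigmaZ} (ha : MinGen n a) : lev a ≤ n + 3 := by
  by_contra! h
  have hb := sigmaZ_bounds a
  -- one of `u`, `u³v⁴`, `uv` divides the monomial, and the quotient is still nonstandard
  have key : ∀ k t : ℤ, 0 < k → k ≤ 2 → (2 * t ≤ k ∧ -(2 * t) ≤ k) →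
      (2 * (row a - t) ≤ lev a - k ∧ -(2 * (row a - t)) ≤ lev a - k) → False := by
    intro k t hk hk' h1 h2
    have h3 := ha.2 (pt _ _ h2) ⟨pt _ _ h1, ext_lev_row
      (by rw [AddSubmonoid.coe_add, lev_add]; simp)
      (by rw [AddSubmonoid.coe_add, row_add]; simp)⟩ (by simp only [Std, lev_pt, row_pt]; omega)
    have := congrArg (fun c : sigmaZ => lev c) h3
    simp only [lev_pt] at this
    omega
  by_cases h1 : 2 * row a = lev a
  · exact key 2 1 (by omega) (by omega) (by omega) (by omega)
  by_cases h2 : -(2 * row a) = lev a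
  · exact key 2 (-1) (by omega) (by omega) (by omega) (by omega)
  exact key 1 0 (by omega) (by omega) (by omega) (by omega)

lemma finite_minGen (n : ℕ) : {a | MinGen n a}.Finite := by
  refine Set.Finite.of_finite_image (f := fun a : sigmaZ => (lev a, row a))
    (Set.Finite.subset ((Set.finite_Icc (0 : ℤ) (n + 3)).prod
      (Set.finite_Icc (-(n + 3) : ℤ) (n + 3))) ?_) ?_
  · rintro _ ⟨a, ha, rfl⟩
    have h1 := MinGen.lev_le ha
    have h2 := sigmaZ_bounds a
    simp only [Set.mem_prod, Set.mem_Icc]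
    omega
  · intro a _ b _ h
    exact ext_lev_row (congrArg Prod.fst h) (congrArg Prod.snd h)

open Classical in
/-- The reduced Gröbner basis of `J n`. -/
def basis (n : ℕ) : Finset S := (finite_minGen n).toFinset.image (nf n)

lemma mem_basis {n : ℕ} {g : S} : g ∈ basis n ↔ ∃ a, MinGen n a ∧ nf n a = g := by
  simp [basis]

lemma isReducedGroebnerBasis_basis (n : ℕ) : IsReducedGroebnerBasis mle (J n) (basis n) where
  mem g hg := by
    obtain ⟨a, -, rfl⟩ := mem_basis.1 hg
    exact nf_mem n a
  ne_zero g hg h0 := by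
    obtain ⟨a, ha, rfl⟩ := mem_basis.1 hg
    simpa [h0] using mem_support_nf_self ha.1
  exists_divides f hf h0 := by
    obtain ⟨a, ha⟩ := exists_isLeadingMonomial h0
    obtain ⟨c, hc, hca⟩ := exists_minGen_divides (not_std_of_isLeadingMonomial hf ha)
    exact ⟨nf n c, mem_basis.2 ⟨c, hc, rfl⟩, c, a, isLeadingMonomial_nf hc.1, ha, hca⟩
  leadingCoeff g hg a ha := by
    obtain ⟨c, hc, rfl⟩ := mem_basis.1 hg
    rw [isLeadingMonomial_unique ha (isLeadingMonomial_nf hc.1), coeff_nf_self hc.1]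
  reduced g hg h hh hne b hb c hc hbc := by
    obtain ⟨a, ha, rfl⟩ := mem_basis.1 hg
    obtain ⟨b', hb', rfl⟩ := mem_basis.1 hh
    obtain rfl := isLeadingMonomial_unique hb (isLeadingMonomial_nf hb'.1)
    by_cases hca : c = a
    · subst hca
      exact hne (by rw [ha.2 b hbc hb'.1])
    · exact hb'.1 (std_of_divides hbc (std_of_mem_support_nf hc hca))

lemma eq_basis {n : ℕ} {G : Finset S} (hG : IsReducedGroebnerBasis mle (J n) G) :
    G = basis n := by
  have key : ∀ c, MinGen n c → ∃ g ∈ G, IsLeadingMonomial mle g c := by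
    intro c hc
    obtain ⟨g, hg, b, a, hb, ha, hba⟩ := hG.exists_divides (nf n c) (nf_mem n c)
      fun h0 => by simpa [h0] using mem_support_nf_self hc.1
    obtain rfl := isLeadingMonomial_unique ha (isLeadingMonomial_nf hc.1)
    exact ⟨g, hg, hc.2 b hba (not_std_of_isLeadingMonomial (hG.mem g hg) hb) ▸ hb⟩
  have key' : ∀ g ∈ G, ∀ c, MinGen n c → IsLeadingMonomial mle g c → nf n c = g := by
    intro g hg c hc hgc
    refine eq_of_mem_J (nf_mem n c) (hG.mem g hg) fun b hb => ?_
    rw [coeff_nf c hb, coeff_mon]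
    by_cases hbc : b = c
    · rw [hbc, Finsupp.single_eq_same, hG.leadingCoeff g hg c hgc]
    rw [Finsupp.single_eq_of_ne hbc]
    by_contra hne
    have hbg : b ∈ g.coeff.support := Finsupp.mem_support_iff.2 (Ne.symm hne)
    obtain ⟨d, hd, hdb⟩ := exists_minGen_divides hb
    obtain ⟨h, hh, hhd⟩ := key d hd
    by_cases hhg : h = g
    · subst hhg
      obtain rfl := isLeadingMonomial_unique hhd hgc
      have h1 := lev_lt_of_divides hdb (Ne.symm hbc)
      have h2 := mle_iff.1 (hgc.2 b hbg)
      omega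
    · exact hG.reduced g hg h hh hhg d hhd b hbg hdb
  ext g
  rw [mem_basis]
  constructor
  · intro hg
    obtain ⟨a, ha⟩ := exists_isLeadingMonomial (hG.ne_zero g hg)
    obtain ⟨c, hc, hca⟩ := exists_minGen_divides (not_std_of_isLeadingMonomial (hG.mem g hg) ha)
    obtain ⟨h, hh, hhc⟩ := key c hc
    obtain rfl : h = g := by
      by_contra hne
      exact hG.reduced g hg h hh hne c hhc a ha.1 hca
    exact ⟨c, hc, key' h hh c hc hhc⟩
  · rintro ⟨c, hc, rfl⟩
    obtain ⟨g, hg, hgc⟩ := key c hc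
    rwa [key' g hg c hc hgc]

lemma mem_marked_basis {n : ℕ} {p : S × sigmaZ} :
    p ∈ marked mle (basis n) ↔ MinGen n p.2 ∧ p.1 = nf n p.2 := by
  obtain ⟨g, a⟩ := p
  constructor
  · rintro ⟨hg, ha⟩
    obtain ⟨c, hc, rfl⟩ := mem_basis.1 hg
    have hac : a = c := isLeadingMonomial_unique ha (isLeadingMonomial_nf hc.1)
    exact ⟨show MinGen n a from hac ▸ hc, show nf n c = nf n a by rw [hac]⟩
  · rintro ⟨ha, hg⟩
    dsimp only at ha hg
    subst hg
    exact ⟨mem_basis.2 ⟨a, ha, rfl⟩, isLeadingMonomial_nf ha.1⟩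

lemma mem_cone_basis {n : ℕ} {w : ℝ × ℝ} : w ∈ cone (marked mle (basis n)) ↔
    w ∈ sigma ∧ ∀ a, MinGen n a → ∀ b ∈ (nf n a).coeff.support,
      0 ≤ dot w ((a : ℤ × ℤ) - (b : ℤ × ℤ)) := by
  refine and_congr_right fun _ => ⟨fun h a ha b hb => h (nf n a, a) (mem_marked_basis.2 ⟨ha, rfl⟩)
    b hb, fun h p hp b hb => ?_⟩
  obtain ⟨ha, hg⟩ := mem_marked_basis.1 hp
  exact h p.2 ha b (hg ▸ hb)

/-! ### The inequalities defining the cone -/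

/-- The slope bounding the cone of `J n`, equal to `n` for odd `n` and to `n + 1` for even `n`. -/
def slope (n : ℕ) : ℤ := 2 * (n / 2 : ℕ) + 1

lemma one_le_slope (n : ℕ) : 1 ≤ slope n := by unfold slope; omega

/-- The value of a weight at the point of level `1` and row `0`. -/
def wlev (w : ℝ × ℝ) : ℝ := w.1 + w.2

/-- The value of a weight at the point of level `0` and row `1`. -/
def wrow (w : ℝ × ℝ) : ℝ := w.1 + 2 * w.2

lemma dot_eq (w : ℝ × ℝ) (a : ℤ × ℤ) : dot w a = wlev w * lev a + wrow w * row a := by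
  simp only [dot, wlev, wrow, lev, row]; push_cast; ring

lemma mem_sigma_iff {w : ℝ × ℝ} : w ∈ sigma ↔ |wrow w| ≤ 2 * wlev w := by
  rw [abs_le]
  simp only [wlev, wrow]
  constructor
  · intro h
    obtain ⟨s, t, rfl⟩ := Submodule.mem_span_pair.1 h
    have hs := s.2
    have ht := t.2
    change -(2 * (((s : ℝ) * 0 + (t : ℝ) * 4) + ((s : ℝ) * 1 + (t : ℝ) * -3))) ≤
      ((s : ℝ) * 0 + (t : ℝ) * 4) + 2 * ((s : ℝ) * 1 + (t : ℝ) * -3) ∧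
      ((s : ℝ) * 0 + (t : ℝ) * 4) + 2 * ((s : ℝ) * 1 + (t : ℝ) * -3) ≤
      2 * (((s : ℝ) * 0 + (t : ℝ) * 4) + ((s : ℝ) * 1 + (t : ℝ) * -3))
    constructor <;> linarith
  · rintro ⟨h1, h2⟩
    refine Submodule.mem_span_pair.2 ⟨⟨w.2 + 3 / 4 * w.1, by linarith⟩, ⟨w.1 / 4, by linarith⟩, ?_⟩
    change ((w.2 + 3 / 4 * w.1) * 0 + (w.1 / 4) * 4, (w.2 + 3 / 4 * w.1) * 1 + (w.1 / 4) * -3) = w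
    ext <;> simp only <;> ring

lemma coeff_nf_one_eq_zero {a b : sigmaZ} (ha : lev a + 2 * row a = 0) (hb : lev b = 1) :
    b ∉ (nf 1 a).coeff.support := by
  have h1 := sigmaZ_bounds b
  have hr : row b = 0 := by omega
  rw [Finsupp.notMem_support_iff]
  have hdeg : DegLT (1 + 1) fun c => ((lev c + 2 * row c : ℤ) : ℂ) * 1 :=
    degLT_one.affine_mul ⟨0, 1, 0, fun c => by simp only [lev, row]; push_cast; ring⟩
  refine coeff_eq_zero_of_degLT (nf_mem 1 a) hdeg (by rw [hb, hr]; norm_num) fun c hc hcb => ?_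
  rw [mul_one, Int.cast_eq_zero]
  by_cases hca : c = a
  · rw [hca, ha]
  have hs := std_of_mem_support_nf hc hca
  have h2 := sigmaZ_bounds c
  have h3 : ¬ (lev c = 1 ∧ row c = 0) := fun h => hcb (ext_lev_row (by omega) (by omega))
  unfold Std at hs
  omega

/-- The inequalities satisfied by the exponents of the elements of the Gröbner basis. -/
lemma nf_support_bound {n : ℕ} (hn : 0 < n) {a b : sigmaZ} (ha : ¬ Std n a)
    (hb : b ∈ (nf n a).coeff.support) (hne : b ≠ a) :
    (0 < lev a - lev b ∨ lev a - lev b = 0 ∧ 0 < row a - row b) ∧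
      0 ≤ slope n * (lev a - lev b) + 2 * (row a - row b) := by
  have hs := std_of_mem_support_nf hb hne
  have h1 := sigmaZ_bounds a
  have h2 := sigmaZ_bounds b
  unfold Std at ha hs
  refine ⟨by omega, ?_⟩
  -- For small differences `d` of levels the estimate is linear, using that the row of a point is at
  -- most half its level; for large `d` the term `slope n * d` dominates.
  obtain ⟨d, hd⟩ : ∃ d, d = lev a - lev b := ⟨_, rfl⟩
  rw [← hd]
  unfold slope
  have hd0 : 0 ≤ d := by omega
  rcases Nat.even_or_odd' n with ⟨m, rfl | rfl⟩
  · rw [show 2 * m / 2 = m by omega]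
    obtain rfl | rfl | hd2 : d = 0 ∨ d = 1 ∨ 2 ≤ d := by omega
    · omega
    · omega
    · have h3 : (m : ℤ) * 2 ≤ m * d := mul_le_mul_of_nonneg_left hd2 (by omega)
      have h4 : (2 * (m : ℤ) + 1) * d = 2 * (m * d) + d := by ring
      rw [h4]
      omega
  · rw [show (2 * m + 1) / 2 = m by omega]
    rcases Nat.eq_zero_or_pos m with rfl | hm
    -- for `n = 1` the estimate may fail for the exponent of `uv`, which does not occur
    · by_cases h : lev a + 2 * row a = 0
      · have h5 : lev b ≠ 1 := fun h5 => coeff_nf_one_eq_zero h h5 hb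
        omega
      · omega
    · obtain rfl | rfl | rfl | hd3 : d = 0 ∨ d = 1 ∨ d = 2 ∨ 3 ≤ d := by omega
      · omega
      · omega
      · omega
      · have h3 : (m : ℤ) * 3 ≤ m * d := mul_le_mul_of_nonneg_left hd3 (by omega)
        have h4 : (2 * (m : ℤ) + 1) * d = 2 * (m * d) + d := by ring
        rw [h4]
        omega

lemma dot_sub_eq (n : ℕ) (w : ℝ × ℝ) (a b : sigmaZ) :
    dot w ((a : ℤ × ℤ) - (b : ℤ × ℤ)) =
      (wlev w - slope n * wrow w / 2) * (lev a - lev b : ℤ) +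
        wrow w / 2 * (slope n * (lev a - lev b) + 2 * (row a - row b) : ℤ) := by
  rw [dot_eq, show lev ((a : ℤ × ℤ) - b) = lev a - lev b by
    simp only [lev, Prod.fst_sub, Prod.snd_sub]; ring, show row ((a : ℤ × ℤ) - b) = row a - row b by
    simp only [row, Prod.fst_sub, Prod.snd_sub]; ring]
  push_cast
  ring

lemma dot_sub_nonneg {n : ℕ} (hn : 0 < n) {w : ℝ × ℝ} (h : 0 ≤ wrow w)
    (h' : slope n * wrow w ≤ 2 * wlev w) {a b : sigmaZ} (ha : ¬ Std n a)
    (hb : b ∈ (nf n a).coeff.support) : 0 ≤ dot w ((a : ℤ × ℤ) - (b : ℤ × ℤ)) := by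
  by_cases hne : b = a
  · simp [hne, dot]
  obtain ⟨h1, h2⟩ := nf_support_bound hn ha hb hne
  rw [dot_sub_eq n]
  exact add_nonneg (mul_nonneg (by linarith) (Int.cast_nonneg (by omega)))
    (mul_nonneg (by linarith) (Int.cast_nonneg h2))

lemma dot_lt_dot {n : ℕ} (hn : 0 < n) {w : ℝ × ℝ} (h : 0 < wrow w)
    (h' : slope n * wrow w < 2 * wlev w) {a b : sigmaZ} (ha : ¬ Std n a)
    (hb : b ∈ (nf n a).coeff.support) (hne : b ≠ a) : dot w b < dot w a := by
  obtain ⟨h1, h2⟩ := nf_support_bound hn ha hb hne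
  have key : 0 < dot w ((a : ℤ × ℤ) - (b : ℤ × ℤ)) := by
    rw [dot_sub_eq n]
    rcases h1 with h1 | ⟨h1, h3⟩
    · exact add_pos_of_pos_of_nonneg (mul_pos (by linarith) (Int.cast_pos.2 h1))
        (mul_nonneg (by linarith) (Int.cast_nonneg h2))
    · rw [h1, Int.cast_zero, mul_zero, zero_add, mul_zero, zero_add]
      exact mul_pos (by linarith) (Int.cast_pos.2 (by omega))
  have := dot_add_right w ((a : ℤ × ℤ) - b) b
  rw [sub_add_cancel] at this
  linarith

/-- A monomial occurs in `nf n a` as soon as some function of degree at most `n` that does not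
vanish at `a` vanishes at all other standard exponents. -/
lemma mem_support_nf_of_degLT {n : ℕ} {a b : sigmaZ} (ha : ¬ Std n a) {p : ℤ × ℤ → ℂ}
    (hp : DegLT (n + 1) p) (hpa : p a ≠ 0) (h : ∀ c : sigmaZ, Std n c → c ≠ b → p c = 0) :
    b ∈ (nf n a).coeff.support := by
  by_contra hb
  have := coeff_eq_zero_of_degLT (nf_mem n a) hp hpa fun c hc hca =>
    h c (std_of_mem_support_nf hc hca) fun hcb => hb (hcb ▸ hc)
  rw [coeff_nf_self ha] at this
  exact one_ne_zero this

lemma prod_row_sub_eq_zero {s : Finset ℤ} {c : ℤ × ℤ} (h : row c ∈ s) :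
    ∏ t ∈ s, ((row c - t : ℤ) : ℂ) = 0 := Finset.prod_eq_zero h (by simp)

lemma prod_row_sub_ne_zero {s : Finset ℤ} {c : ℤ × ℤ} (h : row c ∉ s) :
    ∏ t ∈ s, ((row c - t : ℤ) : ℂ) ≠ 0 := by
  refine Finset.prod_ne_zero_iff.2 fun t ht => Int.cast_ne_zero.2 fun h0 => h ?_
  rwa [sub_eq_zero.1 h0]

lemma prod_lev_sub_eq_zero {s : Finset ℤ} {c : ℤ × ℤ} (h : lev c ∈ s) :
    ∏ t ∈ s, ((lev c - t : ℤ) : ℂ) = 0 := Finset.prod_eq_zero h (by simp)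

lemma prod_lev_sub_ne_zero {s : Finset ℤ} {c : ℤ × ℤ} (h : lev c ∉ s) :
    ∏ t ∈ s, ((lev c - t : ℤ) : ℂ) ≠ 0 := by
  refine Finset.prod_ne_zero_iff.2 fun t ht => Int.cast_ne_zero.2 fun h0 => h ?_
  rwa [sub_eq_zero.1 h0]

/-- The two extremal monomials of level `n + 1` occur in a common element of the basis, which gives
one wall of the cone. -/
lemma mem_support_nf_top {n : ℕ} (hn : 0 < n) {a b : sigmaZ} (hla : lev a = n + 1)
    (hra : row a = ((n + 1) / 2 : ℕ)) (hlb : lev b = n + 1) (hrb : row b = -((n + 1) / 2 : ℕ)) :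
    b ∈ (nf n a).coeff.support := by
  set m := (n + 1) / 2 with hm
  have ha : ¬ Std n a := by unfold Std; omega
  -- Outside the rows strictly between `-m` and `m`, the standard exponents are `b` and, for even
  -- `n = 2 * m`, two of level `n`: the interval of levels is `{n}` for even and empty for odd `n`.
  have hdeg := (degLT_one.prod_mul (Finset.Ico (2 * m : ℤ) (n + 1)) _ isAffine_lev_sub).prod_mul
    (Finset.Ioo (-m : ℤ) m) _ isAffine_row_sub
  refine mem_support_nf_of_degLT ha (hdeg.mono ?_) ?_ fun c hc hcb => ?_
  · rw [Int.card_Ioo, Int.card_Ico]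
    omega
  · rw [mul_one]
    exact mul_ne_zero (prod_row_sub_ne_zero (by rw [Finset.mem_Ioo]; omega))
      (prod_lev_sub_ne_zero (by rw [Finset.mem_Ico]; omega))
  · have h1 := sigmaZ_bounds c
    have h2 : ¬ (lev c = lev b ∧ row c = row b) := fun h => hcb (ext_lev_row h.1 h.2)
    unfold Std at hc
    rw [mul_one]
    by_cases hr : row c ∈ Finset.Ioo (-m : ℤ) m
    · rw [prod_row_sub_eq_zero hr, zero_mul]
    · rw [Finset.mem_Ioo] at hr
      rw [prod_lev_sub_eq_zero (by rw [Finset.mem_Ico]; omega), mul_zero]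

/-- The last monomial of level `n` occurs in the element of the basis led by the first monomial of
level `n + 2`, which gives the other wall of the cone. -/
lemma mem_support_nf_bot {n : ℕ} {a b : sigmaZ} (hla : lev a = n + 2)
    (hra : row a = -((n / 2 : ℕ) + 1)) (hlb : lev b = n) (hrb : row b = (n / 2 : ℕ)) :
    b ∈ (nf n a).coeff.support := by
  set m := n / 2 with hm
  have ha : ¬ Std n a := by unfold Std; omega
  rcases Nat.even_or_odd n with he | ho
  · have he' := Nat.two_mul_div_two_of_even he
    -- `b` is the only standard exponent outside the rows `-m, …, m - 1`
    have hdeg := degLT_one.prod_mul (Finset.Ico (-m : ℤ) m) _ isAffine_row_sub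
    refine mem_support_nf_of_degLT ha (hdeg.mono ?_) ?_ fun c hc hcb => ?_
    · rw [Int.card_Ico]
      omega
    · rw [mul_one]
      exact prod_row_sub_ne_zero (by rw [Finset.mem_Ico]; omega)
    · have h1 := sigmaZ_bounds c
      have h2 : ¬ (lev c = lev b ∧ row c = row b) := fun h => hcb (ext_lev_row h.1 h.2)
      unfold Std at hc
      rw [mul_one, prod_row_sub_eq_zero (by rw [Finset.mem_Ico]; omega)]
  · have ho' := Nat.two_mul_div_two_add_one_of_odd ho
    -- the line through the two standard exponents other than `b` outside the rows `-m, …, m - 1`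
    have hdeg := ((degLT_one.affine_mul (q := fun c =>
      ((n * (lev c - 2 * m) + 2 * (row c - m) : ℤ) : ℂ)) ⟨n * 2 - 2, -n + 2, -(n * 2 * m) - 2 * m,
        fun c => by simp only [lev, row]; push_cast; ring⟩)).prod_mul
      (Finset.Ico (-m : ℤ) m) _ isAffine_row_sub
    refine mem_support_nf_of_degLT ha (hdeg.mono ?_) ?_ fun c hc hcb => ?_
    · rw [Int.card_Ico]
      omega
    · rw [mul_one]
      refine mul_ne_zero (prod_row_sub_ne_zero (by rw [Finset.mem_Ico]; omega)) ?_
      rw [Int.cast_ne_zero, hla, hra, show ((n : ℤ) + 2 - 2 * m) = 3 by omega]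
      omega
    · have h1 := sigmaZ_bounds c
      have h2 : ¬ (lev c = lev b ∧ row c = row b) := fun h => hcb (ext_lev_row h.1 h.2)
      unfold Std at hc
      rw [mul_one]
      by_cases hr : row c ∈ Finset.Ico (-m : ℤ) m
      · rw [prod_row_sub_eq_zero hr, zero_mul]
      rw [Finset.mem_Ico] at hr
      obtain ⟨hl, hr⟩ | ⟨hl, hr⟩ : (lev c = 2 * m ∧ row c = m) ∨
          (lev c = 2 * m + 2 ∧ row c = -(m + 1)) := by omega
      · rw [hl, hr]; simp
      · rw [hl, hr, show (n : ℤ) * (2 * m + 2 - 2 * m) + 2 * (-(m + 1) - m) = 0 by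
          rw [show (n : ℤ) = 2 * m + 1 by omega]; ring]
        simp

lemma minGen_of_lev {n : ℕ} {a : sigmaZ} (ha : ¬ Std n a)
    (h : lev a = n + 1 ∨ lev a = n + 2 ∧ row a < 0) : MinGen n a := by
  refine ⟨ha, ?_⟩
  rintro c ⟨d, rfl⟩ hc
  rw [AddSubmonoid.coe_add, lev_add, row_add] at h
  have h1 := sigmaZ_bounds d
  unfold Std at hc
  have : d = 0 := ext_lev_row (by simp; omega) (by simp; omega)
  rw [this, add_zero]

lemma mem_cone_basis_iff {n : ℕ} (hn : 0 < n) {w : ℝ × ℝ} :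
    w ∈ cone (marked mle (basis n)) ↔ 0 ≤ wrow w ∧ slope n * wrow w ≤ 2 * wlev w := by
  rw [mem_cone_basis]
  constructor
  · rintro ⟨-, h⟩
    constructor
    · have ha : ¬ Std n (pt (n + 1) ((n + 1) / 2 : ℕ) (by omega)) := by
        unfold Std; rw [lev_pt, row_pt]; omega
      have h1 := h (pt (n + 1) ((n + 1) / 2 : ℕ) (by omega)) (minGen_of_lev ha (by simp))
        (pt (n + 1) (-((n + 1) / 2 : ℕ)) (by omega))
        (mem_support_nf_top hn (lev_pt _) (row_pt _) (lev_pt _) (row_pt _))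
      rw [dot_sub_eq 0, lev_pt, lev_pt, row_pt, row_pt, sub_self, mul_zero, Int.cast_zero,
        mul_zero, zero_add, zero_add, mul_nonneg_iff_of_pos_right (Int.cast_pos.2 (by omega))] at h1
      linarith
    · have ha : ¬ Std n (pt (n + 2) (-((n / 2 : ℕ) + 1)) (by omega)) := by
        unfold Std; rw [lev_pt, row_pt]; omega
      have h1 := h (pt (n + 2) (-((n / 2 : ℕ) + 1)) (by omega))
        (minGen_of_lev ha (by rw [lev_pt, row_pt]; omega))
        (pt n (n / 2 : ℕ) (by omega))
        (mem_support_nf_bot (lev_pt _) (row_pt _) (lev_pt _) (row_pt _))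
      rw [dot_sub_eq n, lev_pt, lev_pt, row_pt, row_pt,
        show slope n * (n + 2 - n) + 2 * (-((n / 2 : ℕ) + 1) - (n / 2 : ℕ)) = 0 by
          unfold slope; ring, Int.cast_zero, mul_zero, add_zero, add_sub_cancel_left,
        mul_nonneg_iff_of_pos_right (by norm_num)] at h1
      linarith
  · rintro ⟨h, h'⟩
    refine ⟨?_, fun a ha b hb => dot_sub_nonneg hn h h' ha.1 hb⟩
    rw [mem_sigma_iff, abs_of_nonneg h]
    have : (1 : ℝ) ≤ slope n := by exact_mod_cast one_le_slope n
    nlinarith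

/-! ### Initial ideals -/

/-- The monomial ideal of the elements of `S` without standard monomials. -/
def nonstdIdeal (n : ℕ) : Ideal S where
  carrier := {f | ∀ b ∈ f.coeff.support, ¬ Std n b}
  zero_mem' := by simp
  add_mem' := by
    classical
    intro f g hf hg b hb
    rcases Finset.mem_union.1 (Finsupp.support_add hb) with h | h
    exacts [hf b h, hg b h]
  smul_mem' := by
    classical
    intro c f hf b hb
    obtain ⟨d, -, e, he, rfl⟩ := Finset.mem_add.1
      (AddMonoidAlgebra.support_coeff_mul_subset c f hb)
    exact fun hs => hf e he (std_of_divides ⟨d, add_comm _ _⟩ hs)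

lemma mem_support_initialForm {w : ℝ × ℝ} {f : S} {b : sigmaZ} :
    b ∈ (initialForm w f).coeff.support ↔
      b ∈ f.coeff.support ∧ ∀ c ∈ f.coeff.support, dot w c ≤ dot w b := by
  classical
  change b ∈ (f.coeff.filter _).support ↔ _
  rw [Finsupp.support_filter, Finset.mem_filter]

lemma coeff_initialForm {w : ℝ × ℝ} {f : S} {b : sigmaZ}
    (h : ∀ c ∈ f.coeff.support, dot w c ≤ dot w b) :
    (initialForm w f).coeff b = f.coeff b := by
  classical
  exact Finsupp.filter_apply_pos _ _ h

lemma exists_mem_support_initialForm (w : ℝ × ℝ) {f : S} (hf : f ≠ 0) :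
    ∃ b, b ∈ (initialForm w f).coeff.support := by
  obtain ⟨b, hb, h⟩ := Finset.exists_max_image f.coeff.support (fun c => dot w c)
    (support_nonempty hf)
  exact ⟨b, mem_support_initialForm.2 ⟨hb, h⟩⟩

open Classical in
lemma eq_sum_nf {n : ℕ} {f : S} (hf : f ∈ J n) :
    f = ∑ a ∈ f.coeff.support with ¬ Std n a, f.coeff a • nf n a := by
  refine eq_of_mem_J hf (sum_mem fun a _ => Submodule.smul_of_tower_mem _ _ (nf_mem n a))
    fun b hb => ?_
  rw [AddMonoidAlgebra.coeff_sum, Finsupp.finsetSum_apply]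
  simp only [AddMonoidAlgebra.coeff_smul, Finsupp.smul_apply, coeff_nf _ hb, coeff_mon,
    smul_eq_mul]
  by_cases h : b ∈ f.coeff.support
  · rw [Finset.sum_eq_single b (fun a _ hab => by rw [Finsupp.single_eq_of_ne hab.symm, mul_zero])
      (fun hn => absurd (Finset.mem_filter.2 ⟨h, hb⟩) hn), Finsupp.single_eq_same, mul_one]
  · rw [Finsupp.notMem_support_iff.1 h]
    refine (Finset.sum_eq_zero fun a ha => ?_).symm
    have hab : b ≠ a := fun hab => h (hab ▸ (Finset.mem_filter.1 ha).1)
    rw [Finsupp.single_eq_of_ne hab, mul_zero]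

/-- For a weight in the interior of the cone the initial ideal is the monomial ideal of nonstandard
monomials. -/
lemma initialIdeal_eq {n : ℕ} (hn : 0 < n) {w : ℝ × ℝ} (h : 0 < wrow w)
    (h' : slope n * wrow w < 2 * wlev w) : initialIdeal w (J n) = nonstdIdeal n := by
  apply le_antisymm
  · rw [initialIdeal, Ideal.span_le]
    rintro _ ⟨f, hf, rfl⟩ b hb hs
    obtain ⟨hbf, hmax⟩ := mem_support_initialForm.1 hb
    rw [SetLike.mem_coe] at hf
    classical
    rw [Finsupp.mem_support_iff, eq_sum_nf hf, AddMonoidAlgebra.coeff_sum,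
      Finsupp.finsetSum_apply] at hbf
    obtain ⟨a, ha, hab⟩ := Finset.exists_ne_zero_of_sum_ne_zero hbf
    obtain ⟨ha, has⟩ := Finset.mem_filter.1 ha
    rw [AddMonoidAlgebra.coeff_smul, Finsupp.smul_apply] at hab
    have hba := Finsupp.mem_support_iff.2 (right_ne_zero_of_smul hab)
    exact absurd (hmax a ha) (not_le.2 (dot_lt_dot hn h h' has hba fun hba => has (hba ▸ hs)))
  · intro f hf
    have : AddMonoidAlgebra.supported ℂ ℂ {a : sigmaZ | ¬ Std n a} ≤
        (initialIdeal w (J n)).restrictScalars ℂ := by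
      refine supported_le_iff.2 fun a ha => ?_
      refine Ideal.subset_span ⟨nf n a, nf_mem n a, ?_⟩
      have ha : ¬ Std n a := ha
      have hmax : ∀ c ∈ (nf n a).coeff.support, dot w c ≤ dot w a := fun c hc => by
        by_cases hca : c = a
        · rw [hca]
        · exact (dot_lt_dot hn h h' ha hc hca).le
      ext b
      by_cases hba : b = a
      · rw [hba, coeff_initialForm hmax, coeff_nf_self ha, coeff_mon, Finsupp.single_eq_same]
      · rw [coeff_mon, Finsupp.single_eq_of_ne hba]
        by_contra hb
        obtain ⟨hb, hb'⟩ := mem_support_initialForm.1 (Finsupp.mem_support_iff.2 hb)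
        exact absurd (hb' a (mem_support_nf_self ha)) (not_le.2 (dot_lt_dot hn h h' ha hb hba))
    exact this hf

/-- A weight with monomial initial ideal as above satisfies the inequalities of the cone: otherwise
some initial form would consist of standard monomials. -/
lemma mem_cone_of_initialIdeal_eq {n : ℕ} {w : ℝ × ℝ} (hw : w ∈ sigma)
    (h : initialIdeal w (J n) = nonstdIdeal n) : w ∈ cone (marked mle (basis n)) := by
  refine mem_cone_basis.2 ⟨hw, fun a ha b hb => ?_⟩
  have hne : nf n a ≠ 0 := fun h0 => by simpa [h0] using mem_support_nf_self ha.1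
  obtain ⟨c, hc⟩ := exists_mem_support_initialForm w hne
  have hmem : initialForm w (nf n a) ∈ nonstdIdeal n :=
    h ▸ Ideal.subset_span ⟨nf n a, nf_mem n a, rfl⟩
  obtain ⟨hc', hmax⟩ := mem_support_initialForm.1 hc
  have hca : c = a := by
    by_contra hca
    exact hmem c hc (std_of_mem_support_nf hc' hca)
  have h1 := hmax b hb
  have h2 := dot_add_right w ((a : ℤ × ℤ) - b) b
  rw [sub_add_cancel] at h2
  rw [hca] at h1
  linarith

/-! ### The cone as a member of the Gröbner fan -/

lemma l_eq (n : ℕ) : l n = (2 * (slope n : ℝ) - 2, 2 - (slope n : ℝ)) := by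
  unfold l slope
  split_ifs with h
  · have h1 : ((2 * (n / 2 : ℕ) + 1 : ℕ) : ℝ) = n := by
      rw [Nat.two_mul_div_two_add_one_of_odd h]
    generalize n / 2 = m at h1 ⊢
    push_cast at h1 ⊢
    ext <;> simp only <;> linarith
  · have h1 : ((2 * (n / 2 : ℕ) : ℕ) : ℝ) = n := by
      rw [Nat.two_mul_div_two_of_even (Nat.not_odd_iff_even.1 h)]
    generalize n / 2 = m at h1 ⊢
    push_cast at h1 ⊢
    ext <;> simp only <;> linarith

lemma mem_cone_basis_iff_exists {n : ℕ} (hn : 0 < n) (w : ℝ × ℝ) :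
    w ∈ cone (marked mle (basis n)) ↔
      ∃ s r : ℝ, 0 ≤ s ∧ 0 ≤ r ∧ w = s • ((2 : ℝ), (-1 : ℝ)) + r • l n := by
  rw [mem_cone_basis_iff hn, l_eq]
  constructor
  · rintro ⟨h, h'⟩
    refine ⟨wlev w - slope n * wrow w / 2, wrow w / 2, by linarith, by linarith, ?_⟩
    ext <;> simp [wlev, wrow] <;> ring
  · rintro ⟨s, r, hs, hr, rfl⟩
    simp only [wlev, wrow, Prod.fst_add, Prod.snd_add, Prod.smul_fst, Prod.smul_snd, smul_eq_mul]
    constructor <;> linarith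

lemma cone_basis_mem_groebnerFan {n : ℕ} (hn : 0 < n) :
    (cone (marked mle (basis n)) : Set (ℝ × ℝ)) ∈ groebnerFan (J n) := by
  set w₀ : ℝ × ℝ := ((2 : ℝ), (-1 : ℝ)) + l n with hw₀
  have h1 : wrow w₀ = 2 := by rw [hw₀, l_eq]; simp only [wrow, Prod.mk_add_mk]; ring
  have h2 : wlev w₀ = slope n + 1 := by rw [hw₀, l_eq]; simp only [wlev, Prod.mk_add_mk]; ring
  have hI : initialIdeal w₀ (J n) = nonstdIdeal n :=
    initialIdeal_eq hn (by rw [h1]; norm_num) (by rw [h1, h2]; linarith)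
  have hsig : ∀ w ∈ cone (marked mle (basis n)), w ∈ sigma := fun w hw => hw.1
  refine ⟨w₀, hsig _ ((mem_cone_basis_iff hn).2 ⟨by rw [h1]; norm_num, by rw [h1, h2]; linarith⟩),
    subset_antisymm ?_ (closure_minimal ?_ ?_)⟩
  · intro w hw
    obtain ⟨h3, h4⟩ := (mem_cone_basis_iff hn).1 hw
    have hlim : Filter.Tendsto (fun ε : ℝ => w + ε • w₀) (nhdsWithin 0 (Set.Ioi 0)) (nhds w) := by
      have : Continuous fun ε : ℝ => w + ε • w₀ := by fun_prop
      simpa using (this.tendsto 0).mono_left nhdsWithin_le_nhds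
    refine mem_closure_of_tendsto hlim ?_
    filter_upwards [self_mem_nhdsWithin] with ε hε
    have hε : 0 < ε := hε
    have h5 : wrow (w + ε • w₀) = wrow w + ε * wrow w₀ := by
      simp only [wrow, Prod.fst_add, Prod.snd_add, Prod.smul_fst, Prod.smul_snd, smul_eq_mul]; ring
    have h6 : wlev (w + ε • w₀) = wlev w + ε * wlev w₀ := by
      simp only [wlev, Prod.fst_add, Prod.snd_add, Prod.smul_fst, Prod.smul_snd, smul_eq_mul]; ring
    have h7 : 0 < wrow (w + ε • w₀) := by rw [h5, h1]; linarith
    have h8 : slope n * wrow (w + ε • w₀) < 2 * wlev (w + ε • w₀) := by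
      rw [h5, h6, h1, h2]; linarith
    exact ⟨hsig _ ((mem_cone_basis_iff hn).2 ⟨h7.le, h8.le⟩),
      (initialIdeal_eq hn h7 h8).trans hI.symm⟩
  · rintro w ⟨hw, h⟩
    exact mem_cone_of_initialIdeal_eq hw (h.trans hI)
  · have : (cone (marked mle (basis n)) : Set (ℝ × ℝ)) =
        {w | 0 ≤ wrow w} ∩ {w | slope n * wrow w ≤ 2 * wlev w} := by
      ext w
      exact mem_cone_basis_iff hn
    rw [this]
    unfold wrow wlev
    exact (isClosed_le (by fun_prop) (by fun_prop)).inter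
      (isClosed_le (by fun_prop) (by fun_prop))

/-! ### Rays of a two-dimensional cone -/

lemma eq_zero_of_smul_add_smul {v₁ v₂ : ℝ × ℝ} (hv : v₁.1 * v₂.2 - v₁.2 * v₂.1 ≠ 0) {s r : ℝ}
    (h : s • v₁ + r • v₂ = 0) : s = 0 ∧ r = 0 := by
  have h1 := congrArg Prod.fst h
  have h2 := congrArg Prod.snd h
  simp only [Prod.fst_add, Prod.snd_add, Prod.smul_fst, Prod.smul_snd, smul_eq_mul, Prod.fst_zero,
    Prod.snd_zero] at h1 h2
  constructor <;> refine (mul_eq_zero.1 ?_).resolve_right hv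
  · linear_combination v₂.2 * h1 - v₂.1 * h2
  · linear_combination v₁.1 * h2 - v₁.2 * h1

lemma coneDim_eq_two {C : PointedCone ℝ (ℝ × ℝ)} {v₁ v₂ : ℝ × ℝ}
    (hv : v₁.1 * v₂.2 - v₁.2 * v₂.1 ≠ 0) (h₁ : v₁ ∈ C) (h₂ : v₂ ∈ C) : coneDim C = 2 := by
  have hli : LinearIndependent ℝ ![v₁, v₂] :=
    LinearIndependent.pair_iff.2 fun s r h => eq_zero_of_smul_add_smul hv h
  have htop : Submodule.span ℝ (C : Set (ℝ × ℝ)) = ⊤ := by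
    refine top_le_iff.1 ?_
    rw [← hli.span_eq_top_of_card_eq_finrank (by simp)]
    refine Submodule.span_mono ?_
    rintro _ ⟨i, rfl⟩
    fin_cases i
    exacts [h₁, h₂]
  rw [coneDim, htop, finrank_top]
  simp

lemma mem_halfLine {v w : ℝ × ℝ} : w ∈ halfLine v ↔ ∃ s : ℝ, 0 ≤ s ∧ w = s • v := by
  rw [halfLine, PointedCone.hull, Submodule.mem_span_singleton]
  exact ⟨fun ⟨s, hs⟩ => ⟨s, s.2, hs.symm⟩, fun ⟨s, hs, h⟩ => ⟨⟨s, hs⟩, h.symm⟩⟩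

lemma coneDim_halfLine {v : ℝ × ℝ} (hv : v ≠ 0) : coneDim (halfLine v) = 1 := by
  have : Submodule.span ℝ (halfLine v : Set (ℝ × ℝ)) = Submodule.span ℝ {v} :=
    Submodule.span_span_of_tower _ _ _
  rw [coneDim, this, finrank_span_singleton hv]

lemma isRay_halfLine {C : PointedCone ℝ (ℝ × ℝ)} {v₁ v₂ : ℝ × ℝ}
    (hv : v₁.1 * v₂.2 - v₁.2 * v₂.1 ≠ 0)
    (hC : ∀ w, w ∈ C ↔ ∃ s r : ℝ, 0 ≤ s ∧ 0 ≤ r ∧ w = s • v₁ + r • v₂) :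
    IsRay C (halfLine v₁) := by
  refine ⟨⟨fun w hw => ?_, ?_⟩, coneDim_halfLine ?_⟩
  · obtain ⟨s, hs, rfl⟩ := mem_halfLine.1 hw
    exact (hC _).2 ⟨s, 0, hs, le_rfl, by simp⟩
  · intro x y a hx hy ha h
    obtain ⟨s, r, hs, hr, rfl⟩ := (hC _).1 hx
    obtain ⟨s', r', hs', hr', rfl⟩ := (hC _).1 hy
    obtain ⟨t, -, h⟩ := mem_halfLine.1 h
    have h0 := (eq_zero_of_smul_add_smul hv (s := a * s + s' - t) (r := a * r + r') (by
      rw [← sub_eq_zero] at h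
      rw [← h]
      module)).2
    have hr0 : r = 0 := by
      have := mul_nonneg ha.le hr
      have : a * r = 0 := by linarith
      exact (mul_eq_zero.1 this).resolve_left ha.ne'
    exact mem_halfLine.2 ⟨s, hs, by simp [hr0]⟩
  · rintro rfl
    simp at hv

lemma isRay_iff {C : PointedCone ℝ (ℝ × ℝ)} {v₁ v₂ : ℝ × ℝ} (hv : v₁.1 * v₂.2 - v₁.2 * v₂.1 ≠ 0)
    (hC : ∀ w, w ∈ C ↔ ∃ s r : ℝ, 0 ≤ s ∧ 0 ≤ r ∧ w = s • v₁ + r • v₂)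
    (L : PointedCone ℝ (ℝ × ℝ)) : IsRay C L ↔ L = halfLine v₁ ∨ L = halfLine v₂ := by
  constructor
  · rintro ⟨hF, hdim⟩
    have h₁ : v₁ ∈ C := (hC _).2 ⟨1, 0, zero_le_one, le_rfl, by simp⟩
    have h₂ : v₂ ∈ C := (hC _).2 ⟨0, 1, le_rfl, zero_le_one, by simp⟩
    have hs : ∀ {s r : ℝ}, 0 ≤ s → 0 ≤ r → s • v₁ + r • v₂ ∈ L → s ≠ 0 → v₁ ∈ L :=
      fun {s r} hs hr h hs0 => hF.2 h₁ ((hC (r • v₂)).2 ⟨0, r, le_rfl, hr, by simp⟩)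
        (lt_of_le_of_ne hs hs0.symm) h
    have hr : ∀ {s r : ℝ}, 0 ≤ s → 0 ≤ r → s • v₁ + r • v₂ ∈ L → r ≠ 0 → v₂ ∈ L :=
      fun {s r} hs hr h hr0 => hF.2 h₂ ((hC (s • v₁)).2 ⟨s, 0, hs, le_rfl, by simp⟩)
        (lt_of_le_of_ne hr hr0.symm) (by rwa [add_comm])
    have hnot : ¬ (v₁ ∈ L ∧ v₂ ∈ L) := fun h => by
      have := coneDim_eq_two hv h.1 h.2
      omega
    by_cases hv₁ : v₁ ∈ L
    · left
      refine le_antisymm (fun w hw => ?_) (Submodule.span_le.2 (by simpa using hv₁))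
      obtain ⟨s, r, hs0, hr0, rfl⟩ := (hC w).1 (hF.1 hw)
      have : r = 0 := by
        by_contra h
        exact hnot ⟨hv₁, hr hs0 hr0 hw h⟩
      exact mem_halfLine.2 ⟨s, hs0, by simp [this]⟩
    · have hL : ∀ w ∈ L, ∃ r : ℝ, 0 ≤ r ∧ w = r • v₂ := by
        intro w hw
        obtain ⟨s, r, hs0, hr0, rfl⟩ := (hC w).1 (hF.1 hw)
        have : s = 0 := by
          by_contra h
          exact hv₁ (hs hs0 hr0 hw h)
        exact ⟨r, hr0, by simp [this]⟩
      right
      have hv₂ : v₂ ∈ L := by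
        by_contra hv₂
        have : Submodule.span ℝ (L : Set (ℝ × ℝ)) = ⊥ := by
          rw [Submodule.span_eq_bot]
          intro w hw
          obtain ⟨r, hr0, rfl⟩ := hL w hw
          have : r = 0 := by
            by_contra h
            exact hv₂ (hr (s := 0) le_rfl hr0 (by simpa using hw) h)
          simp [this]
        rw [coneDim, this, finrank_bot] at hdim
        exact zero_ne_one hdim
      exact le_antisymm (fun w hw => mem_halfLine.2 (hL w hw))
        (Submodule.span_le.2 (by simpa using hv₂))
  · rintro (rfl | rfl)
    · exact isRay_halfLine hv hC
    · refine isRay_halfLine (v₂ := v₁) (fun h => hv (by linarith)) fun w => (hC w).trans ?_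
      exact ⟨fun ⟨s, r, hs, hr, h⟩ => ⟨r, s, hr, hs, by rw [h, add_comm]⟩,
        fun ⟨s, r, hs, hr, h⟩ => ⟨r, s, hr, hs, by rw [h, add_comm]⟩⟩

lemma det_l (n : ℕ) : (((2 : ℝ), (-1 : ℝ)) : ℝ × ℝ).1 * (l n).2 -
    (((2 : ℝ), (-1 : ℝ)) : ℝ × ℝ).2 * (l n).1 ≠ 0 := by
  rw [l_eq]
  ring_nf
  norm_num

end A3Nash

end

theorem mainTheorem3 (n : ℕ) (hn : 0 < n) :
    (∃! G : Finset A3Nash.S, A3Nash.IsReducedGroebnerBasis A3Nash.mle (A3Nash.J n) G) ∧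
    ∀ G : Finset A3Nash.S, A3Nash.IsReducedGroebnerBasis A3Nash.mle (A3Nash.J n) G →
      (A3Nash.cone (A3Nash.marked A3Nash.mle G) : Set (ℝ × ℝ)) ∈ A3Nash.groebnerFan (A3Nash.J n) ∧
      A3Nash.coneDim (A3Nash.cone (A3Nash.marked A3Nash.mle G)) = 2 ∧
      ∀ L : PointedCone ℝ (ℝ × ℝ),
        A3Nash.IsRay (A3Nash.cone (A3Nash.marked A3Nash.mle G)) L ↔
          L = A3Nash.halfLine (2, -1) ∨ L = A3Nash.halfLine (A3Nash.l n) := by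
  refine ⟨⟨A3Nash.basis n, A3Nash.isReducedGroebnerBasis_basis n, fun G hG =>
    A3Nash.eq_basis hG⟩, fun G hG => ?_⟩
  rw [A3Nash.eq_basis hG]
  have hC := A3Nash.mem_cone_basis_iff_exists hn
  exact ⟨A3Nash.cone_basis_mem_groebnerFan hn,
    A3Nash.coneDim_eq_two (A3Nash.det_l n) ((hC _).2 ⟨1, 0, zero_le_one, le_rfl, by simp⟩)
      ((hC _).2 ⟨0, 1, le_rfl, zero_le_one, by simp⟩),
    A3Nash.isRay_iff (A3Nash.det_l n) hC⟩
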